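/- Let $0<\beta<1/2$ and $0\le\theta\le 1$. All functions are real-valued. For a function $w$ on $(0,1)$ put $$I^\beta_\theta w(x)=\frac{\theta}{\Gamma(\beta)}\int_0^x\frac{w(s)}{(x-s)^{1-\beta}}\,ds+\frac{1-\theta}{\Gamma(\beta)}\int_x^1\frac{w(s)}{(s-x)^{1-\beta}}\,ds .$$ Let $H^{1-\beta}_0(0,1)$ be the completion of $C_0^\infty(0,1)$ with respect to the norm $\|w\|=\bigl(\|w\|_{L^2(\mathbb R)}^2+\||\xi|^{1-\beta}\mathcal F w\|_{L^2(\mathbb R)}^2\bigr)^{1/2}$, where $\mathcal F$ is the Fourier transform; its elements are functions in $L^2(\mathbb R)$ that vanish a.e. outside $(0,1)$. Let $H^1(0,1)$ be the Sobolev space of all $w\in L^2(0,1)$ with weak derivative $Dw\in L^2(0,1)$, with the norm $(\|w\|_{L^2(0,1)}^2+\|Dw\|_{L^2(0,1)}^2)^{1/2}$. Then for every $\phi\in H^{1-\beta}_0(0,1)$ both integrals defining $I^\beta_\theta\phi(x)$ converge absolutely for every $x\in[0,1]$, and $I^\beta_\theta$ is a bounded linear operator from $H^{1-\beta}_0(0,1)$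 to $H^1(0,1)$. It is a bijection from $H^{1-\beta}_0(0,1)$ onto its range $$\mathcal R(I^\beta_\theta)=\{w\in H^1(0,1):\ \exists\,\phi\in H^{1-\beta}_0(0,1),\ w=I^\beta_\theta\phi\},$$ this range is a closed subspace of $H^1(0,1)$, and the inverse operator $(I^\beta_\theta)^{-1}:\mathcal R(I^\beta_\theta)\to H^{1-\beta}_0(0,1)$ is bounded. -/

import Mathlib

open MeasureTheory Set
open scoped FourierTransform ContDiff

noncomputable section

/-- The left Riemann-Liouville fractional integral of order `σ` based at `a`. -/
def leftFracInt (a σ : ℝ) (w : ℝ → ℝ) (x : ℝ) : ℝ :=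
  1 / Real.Gamma σ * ∫ s in a..x, w s / (x - s) ^ (1 - σ)

/-- The right Riemann-Liouville fractional integral of order `σ` based at `b`. -/
def rightFracInt (b σ : ℝ) (w : ℝ → ℝ) (x : ℝ) : ℝ :=
  1 / Real.Gamma σ * ∫ s in x..b, w s / (s - x) ^ (1 - σ)

/-- The two-sided fractional integral operator on `(a, b)`, acting on functions. -/
def twoSidedFracInt (a b θ σ : ℝ) (w : ℝ → ℝ) (x : ℝ) : ℝ :=
  θ * leftFracInt a σ w x + (1 - θ) * rightFracInt b σ w x

/-- `w ∈ C_0^∞(a, b)`: smooth on `ℝ`, with compact support contained in `(a, b)`. -/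
structure IsTestFunction (a b : ℝ) (w : ℝ → ℝ) : Prop where
  smooth : ContDiff ℝ ∞ w
  hasCompactSupport : HasCompactSupport w
  tsupport_subset : tsupport w ⊆ Ioo a b

theorem IsTestFunction.zero (a b : ℝ) : IsTestFunction a b 0 where
  smooth := contDiff_const
  hasCompactSupport := HasCompactSupport.zero
  tsupport_subset := by simp [tsupport]

theorem IsTestFunction.add {a b : ℝ} {w v : ℝ → ℝ} (hw : IsTestFunction a b w)
    (hv : IsTestFunction a b v) : IsTestFunction a b (w + v) where
  smooth := hw.smooth.add hv.smooth
  hasCompactSupport := hw.hasCompactSupport.add hv.hasCompactSupport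
  tsupport_subset := (tsupport_add w v).trans
    (union_subset hw.tsupport_subset hv.tsupport_subset)

theorem IsTestFunction.const_smul {a b : ℝ} {w : ℝ → ℝ} (c : ℝ) (hw : IsTestFunction a b w) :
    IsTestFunction a b (c • w) where
  smooth := contDiff_const.smul hw.smooth
  hasCompactSupport := hw.hasCompactSupport.smul_left (f := fun _ => c)
  tsupport_subset := (closure_mono (Function.support_const_smul_subset c w)).trans
    hw.tsupport_subset

theorem IsTestFunction.integrable_ofReal {a b : ℝ} {w : ℝ → ℝ} (hw : IsTestFunction a b w) :
    Integrable (fun x => (w x : ℂ)) :=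
  (hw.smooth.continuous.integrable_of_hasCompactSupport hw.hasCompactSupport).ofReal

/-- The space of pairs `(w, g)` in `L²(ℝ; ℝ) × L²(ℝ; ℂ)` with the norm
`(‖w‖² + ‖g‖²) ^ (1/2)`. -/
abbrev PairSpaceLine : Type :=
  WithLp 2 (Lp ℝ 2 (volume : Measure ℝ) × Lp ℂ 2 (volume : Measure ℝ))

/-- `C_0^∞(a, b)` inside `PairSpaceLine`, through `w ↦ (w, |ξ|^μ 𝓕 w)`. The norm induced on it is
the norm `‖w‖_{H^μ(ℝ)} = (‖w‖² + ‖|ξ|^μ 𝓕 w‖²) ^ (1/2)`. -/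
def testGraph (μ a b : ℝ) : Submodule ℝ PairSpaceLine where
  carrier := {p | ∃ w : ℝ → ℝ, IsTestFunction a b w ∧ p.fst =ᵐ[volume] w ∧
    p.snd =ᵐ[volume] fun ξ => ((|ξ| ^ μ : ℝ) : ℂ) * 𝓕 (fun x => (w x : ℂ)) ξ}
  zero_mem' := by
    refine ⟨0, IsTestFunction.zero a b, Lp.coeFn_zero _ _ _, ?_⟩
    filter_upwards [Lp.coeFn_zero ℂ 2 (volume : Measure ℝ)] with ξ h
    rw [WithLp.zero_snd, h]
    simp [Real.fourier_eq]
  add_mem' := by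
    rintro p q ⟨w, hw, hp, hp'⟩ ⟨v, hv, hq, hq'⟩
    refine ⟨w + v, hw.add hv, (Lp.coeFn_add _ _).trans (hp.add hq), ?_⟩
    filter_upwards [Lp.coeFn_add p.snd q.snd, hp', hq'] with ξ h h1 h2
    have e : (fun x => ((w + v) x : ℂ)) = (fun x => (w x : ℂ)) + fun x => (v x : ℂ) := by
      ext x; simp
    have e' : 𝓕 ((fun x => (w x : ℂ)) + fun x => (v x : ℂ)) ξ
        = 𝓕 (fun x => (w x : ℂ)) ξ + 𝓕 (fun x => (v x : ℂ)) ξ := by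
      simp only [Real.fourier_eq, Pi.add_apply, smul_add]
      exact integral_add ((Real.fourierIntegral_convergent_iff ξ).2 hw.integrable_ofReal)
        ((Real.fourierIntegral_convergent_iff ξ).2 hv.integrable_ofReal)
    rw [WithLp.add_snd, h, Pi.add_apply, h1, h2, e, e', mul_add]
  smul_mem' := by
    rintro c p ⟨w, hw, hp, hp'⟩
    refine ⟨c • w, hw.const_smul c, (Lp.coeFn_smul _ _).trans (hp.const_smul c), ?_⟩
    filter_upwards [Lp.coeFn_smul c p.snd, hp'] with ξ h h1
    have e : (fun x => ((c • w) x : ℂ)) = c • fun x => (w x : ℂ) := by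
      ext x; simp
    have e' : 𝓕 (c • fun x => (w x : ℂ)) ξ = c • 𝓕 (fun x => (w x : ℂ)) ξ := by
      simp only [Real.fourier_eq, Pi.smul_apply]
      rw [← integral_smul]
      exact integral_congr_ae (Filter.Eventually.of_forall fun x => smul_comm _ _ _)
    rw [WithLp.smul_snd, h, Pi.smul_apply, h1, e, e', mul_smul_comm]

/-- The fractional Sobolev space `H^μ_0(a, b)`: the completion of `C_0^∞(a, b)` with respect to
`‖·‖_{H^μ(ℝ)}`, realised as a closure inside a Hilbert space. An element `φ` is the pair of the
function `φ.1.fst` (which determines it) and `|ξ|^μ` times the Fourier transform of it. -/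
def HZero (μ a b : ℝ) : Submodule ℝ PairSpaceLine :=
  (testGraph μ a b).topologicalClosure

/-- The function on `ℝ` (zero a.e. outside `(a, b)`) that an element of `H^μ_0(a, b)` is. -/
def HZero.fn {μ a b : ℝ} (φ : HZero μ a b) : ℝ → ℝ := φ.1.fst

/-- The space of pairs `(w, g)` in `L²(a, b) × L²(a, b)` with the norm
`(‖w‖² + ‖g‖²) ^ (1/2)`. -/
abbrev PairSpace (a b : ℝ) : Type :=
  WithLp 2 (Lp ℝ 2 (volume.restrict (Ioo a b)) × Lp ℝ 2 (volume.restrict (Ioo a b)))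

theorem integrable_Lp_mul {a b : ℝ} (w : Lp ℝ 2 (volume.restrict (Ioo a b)))
    {v : ℝ → ℝ} (hv : Continuous v) (hs : HasCompactSupport v) :
    Integrable (fun x => w x * v x) (volume.restrict (Ioo a b)) :=
  (Lp.memLp w).integrable_mul (q := 2) ((hv.memLp_of_hasCompactSupport hs).restrict _)

/-- The Sobolev space `H¹(a, b)`: the functions `w ∈ L²(a, b)` with a weak derivative
`g ∈ L²(a, b)`, as the pairs `(w, g)`, with the norm `(‖w‖² + ‖g‖²) ^ (1/2)`. -/
def HOne (a b : ℝ) : Submodule ℝ (PairSpace a b) where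
  carrier := {p | ∀ v : ℝ → ℝ, IsTestFunction a b v →
    ∫ x in Ioo a b, p.fst x * deriv v x = -∫ x in Ioo a b, p.snd x * v x}
  zero_mem' := by
    intro v _
    have h := Lp.coeFn_zero ℝ 2 (volume.restrict (Ioo a b))
    rw [integral_eq_zero_of_ae, integral_eq_zero_of_ae, neg_zero] <;>
    · filter_upwards [h] with x hx
      have hx' := hx
      simp only [Pi.zero_apply] at hx'
      simp only [WithLp.zero_fst, WithLp.zero_snd, hx', zero_mul, Pi.zero_apply]
  add_mem' := by
    intro p q hp hq v hv
    have hd : Continuous (deriv v) := hv.smooth.continuous_deriv (by simp)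
    have hds := hv.hasCompactSupport.deriv
    have hc := hv.smooth.continuous
    have hcs := hv.hasCompactSupport
    have e1 : ∫ x in Ioo a b, (p + q).fst x * deriv v x
        = (∫ x in Ioo a b, p.fst x * deriv v x) + ∫ x in Ioo a b, q.fst x * deriv v x := by
      rw [← integral_add (integrable_Lp_mul _ hd hds)
        (integrable_Lp_mul _ hd hds)]
      refine integral_congr_ae ?_
      filter_upwards [Lp.coeFn_add p.fst q.fst] with x hx
      rw [WithLp.add_fst, hx, Pi.add_apply, add_mul]
    have e2 : ∫ x in Ioo a b, (p + q).snd x * v x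
        = (∫ x in Ioo a b, p.snd x * v x) + ∫ x in Ioo a b, q.snd x * v x := by
      rw [← integral_add (integrable_Lp_mul _ hc hcs)
        (integrable_Lp_mul _ hc hcs)]
      refine integral_congr_ae ?_
      filter_upwards [Lp.coeFn_add p.snd q.snd] with x hx
      rw [WithLp.add_snd, hx, Pi.add_apply, add_mul]
    rw [e1, e2, hp v hv, hq v hv]
    ring
  smul_mem' := by
    intro c p hp v hv
    have e1 : ∫ x in Ioo a b, (c • p).fst x * deriv v x
        = c * ∫ x in Ioo a b, p.fst x * deriv v x := by
      rw [← integral_const_mul]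
      refine integral_congr_ae ?_
      filter_upwards [Lp.coeFn_smul c p.fst] with x hx
      rw [WithLp.smul_fst, hx, Pi.smul_apply, smul_eq_mul, mul_assoc]
    have e2 : ∫ x in Ioo a b, (c • p).snd x * v x = c * ∫ x in Ioo a b, p.snd x * v x := by
      rw [← integral_const_mul]
      refine integral_congr_ae ?_
      filter_upwards [Lp.coeFn_smul c p.snd] with x hx
      rw [WithLp.smul_snd, hx, Pi.smul_apply, smul_eq_mul, mul_assoc]
    rw [e1, e2, hp v hv]
    ring

/-- The function on `(a, b)` that an element of `H¹(a, b)` is. -/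
def HOne.fn {a b : ℝ} (w : HOne a b) : ℝ → ℝ := w.1.fst

/-- The range of the two-sided fractional integral operator on `H^{1-β}_0(0, 1)`: those
`w ∈ H¹(0, 1)` with `w = I φ` (a.e. on `(0, 1)`) for some `φ ∈ H^{1-β}_0(0, 1)`. -/
def fracIntRange (β θ : ℝ) : Set (HOne 0 1) :=
  {w | ∃ φ : HZero (1 - β) 0 1,
    HOne.fn w =ᵐ[volume.restrict (Ioo (0 : ℝ) 1)] twoSidedFracInt 0 1 θ β (HZero.fn φ)}

end

noncomputable section

/-! The core is a lower bound for the derivative of the operator. In the convention $e^{-2\pi i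
x\xi}$, the left integral (`e = 1`) and the right integral (`e = -1`) of order $\beta$ on the line
have multipliers $(2\pi i e\xi)^{-\beta}$. Their derivatives $a$, $b$ therefore have Fourier
transforms $\sigma_{\pm}(\xi)\,|\xi|^{1-\beta}\hat\varphi(\xi)$, where $|\sigma_\pm| =
(2\pi)^{1-\beta}$ and $\mathrm{Re}(\overline{\sigma_+}\sigma_-) =
\cos(\pi\beta)(2\pi)^{2(1-\beta)}$. The last quantity does not depend on $\xi$ and is positive for
$0<\beta<1/2$ (`re_conj_fracSymbol_mul`). Put $N = (2\pi)^{1-\beta}\||\xi|^{1-\beta}\hat\varphi\|$.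
On the line $\|a\| = \|b\| = N$ and $\langle a,b\rangle = \cos(\pi\beta)N^2$.

For $\varphi$ supported in $(0,1)$, $a$ vanishes on $x<0$ and $b$ on $x>1$, so the product $ab$
lives on $(0,1)$ and $\langle a,b\rangle$ is unchanged by restriction to the interval
(`inner_fracDerivLp`). The restricted norms can only decrease. Pairing $\theta a+(1-\theta)b$ with
$a+b$ in $L^2(0,1)$ gives $\theta\|a\|^2+(1-\theta)\|b\|^2+\langle a,b\rangle \ge
\cos(\pi\beta)N^2$, while $\|a+b\|\le 2N$. Hence the derivative has norm at least
$\cos(\pi\beta)N/2$, uniformly in $\theta$ (`norm_snd_le_twoSidedFracDerivLp`).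

Since $1-\beta>1/2$, elements of the space are bounded by a multiple of the homogeneous seminorm
(`HZero.ae_abs_le`). This gives absolute convergence of the integrals, the $L^2$ bound, and a
Poincaré inequality turning the lower bound into one for the full norm. A bounded operator on a
complete space that is bounded below is injective, has closed range and has a bounded inverse.

The multiplier formula is proved weakly: for test functions by pairing with derivatives of test
functions, then for the completion by continuity. -/

/-! ### Laplace transform of the power kernel -/

theorem integrableOn_rpow_mul_exp {s c : ℝ} (hs : -1 < s) (hc : 0 < c) :
    IntegrableOn (fun t : ℝ => t ^ s * Real.exp (-(c * t))) (Ioi 0) := by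
  simpa [Real.rpow_one, neg_mul] using
    integrableOn_rpow_mul_exp_neg_mul_rpow (p := 1) hs one_pos hc

theorem norm_cexp_neg_mul_ofReal (r : ℂ) (t : ℝ) :
    ‖Complex.exp (-(r * t))‖ = Real.exp (-(r.re * t)) := by
  simp [Complex.norm_exp]

theorem aestronglyMeasurable_rpow_mul_cexp (s : ℝ) (r : ℂ) (μ : Measure ℝ) :
    AEStronglyMeasurable (fun t : ℝ => ((t ^ s : ℝ) : ℂ) * Complex.exp (-(r * t))) μ := by
  have : Measurable fun t : ℝ => t ^ s := measurable_id.pow_const s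
  exact ((Complex.measurable_ofReal.comp this).mul (by fun_prop)).aestronglyMeasurable

theorem integrableOn_rpow_mul_cexp {s : ℝ} (hs : -1 < s) {r : ℂ} (hr : 0 < r.re) :
    IntegrableOn (fun t : ℝ => ((t ^ s : ℝ) : ℂ) * Complex.exp (-(r * t))) (Ioi 0) := by
  refine (integrableOn_rpow_mul_exp hs hr).mono' (aestronglyMeasurable_rpow_mul_cexp _ _ _) ?_
  filter_upwards [ae_restrict_mem measurableSet_Ioi] with t ht
  have h0 : 0 ≤ t ^ s := Real.rpow_nonneg (le_of_lt ht) _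
  rw [norm_mul, norm_cexp_neg_mul_ofReal, Complex.norm_real, Real.norm_of_nonneg h0]

/-- Differentiation under the integral sign. On the half-plane where the real part exceeds half that
of `r`, the derivative of the integrand has a single integrable majorant. Holomorphy is needed for
the identity theorem. -/
theorem hasDerivAt_laplace_rpow {β : ℝ} (hβ : 0 < β) {r : ℂ} (hr : 0 < r.re) :
    HasDerivAt (fun r : ℂ => ∫ t in Ioi (0 : ℝ), ((t ^ (β - 1) : ℝ) : ℂ) * Complex.exp (-(r * t)))
      (∫ t in Ioi (0 : ℝ), ((t ^ (β - 1) : ℝ) : ℂ) * (Complex.exp (-(r * t)) * -t)) r := by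
  have hU : {z : ℂ | r.re / 2 < z.re} ∈ nhds r :=
    (isOpen_lt continuous_const Complex.continuous_re).mem_nhds (by simp; linarith)
  refine (hasDerivAt_integral_of_dominated_loc_of_deriv_le (𝕜 := ℂ)
    (μ := volume.restrict (Ioi (0 : ℝ)))
    (F := fun r t => ((t ^ (β - 1) : ℝ) : ℂ) * Complex.exp (-(r * t)))
    (F' := fun r t => ((t ^ (β - 1) : ℝ) : ℂ) * (Complex.exp (-(r * t)) * -t))
    (bound := fun t => t ^ β * Real.exp (-(r.re / 2 * t))) hU ?_ ?_ ?_ ?_ ?_ ?_).2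
  · exact Filter.Eventually.of_forall fun z => aestronglyMeasurable_rpow_mul_cexp _ _ _
  · exact integrableOn_rpow_mul_cexp (by linarith) hr
  · have := (aestronglyMeasurable_rpow_mul_cexp (β - 1) r (volume.restrict (Ioi (0 : ℝ)))).mul
      (Complex.continuous_ofReal.neg.aestronglyMeasurable)
    refine this.congr (Filter.Eventually.of_forall fun t => ?_)
    simp [mul_assoc]
  · filter_upwards [ae_restrict_mem measurableSet_Ioi] with t (ht : 0 < t) z hz
    have h0 : 0 ≤ t ^ (β - 1) := Real.rpow_nonneg ht.le _
    rw [norm_mul, norm_mul, norm_cexp_neg_mul_ofReal, Complex.norm_real, Real.norm_of_nonneg h0,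
      norm_neg, Complex.norm_real, Real.norm_of_nonneg ht.le]
    have h1 : t ^ β = t ^ (β - 1) * t := by
      rw [← Real.rpow_add_one ht.ne', sub_add_cancel]
    have h2 : Real.exp (-(z.re * t)) ≤ Real.exp (-(r.re / 2 * t)) := by
      apply Real.exp_le_exp.2
      have hz : r.re / 2 < z.re := hz
      nlinarith
    rw [h1]
    calc t ^ (β - 1) * (Real.exp (-(z.re * t)) * t)
        ≤ t ^ (β - 1) * (Real.exp (-(r.re / 2 * t)) * t) := by gcongr
      _ = _ := by ring
  · exact integrableOn_rpow_mul_exp (by linarith) (by linarith)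
  · refine Filter.Eventually.of_forall fun t z _ => ?_
    have h : HasDerivAt (fun z : ℂ => -(z * t)) (-t) z := by
      simpa using! ((hasDerivAt_id z).mul_const (t : ℂ)).neg
    exact h.cexp.const_mul _

/-- Both sides are holomorphic on the right half-plane and agree on the real axis by the Gamma
integral, so the identity theorem applies. -/
theorem laplace_rpow {β : ℝ} (hβ : 0 < β) {r : ℂ} (hr : 0 < r.re) :
    ∫ t in Ioi (0 : ℝ), ((t ^ (β - 1) : ℝ) : ℂ) * Complex.exp (-(r * t))
      = r ^ (-(β : ℂ)) * Real.Gamma β := by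
  have hopen : IsOpen {z : ℂ | 0 < z.re} := isOpen_lt continuous_const Complex.continuous_re
  have hL : AnalyticOnNhd ℂ (fun r : ℂ => ∫ t in Ioi (0 : ℝ),
      ((t ^ (β - 1) : ℝ) : ℂ) * Complex.exp (-(r * t))) {z | 0 < z.re} :=
    DifferentiableOn.analyticOnNhd (fun z hz =>
      (hasDerivAt_laplace_rpow hβ hz).differentiableAt.differentiableWithinAt) hopen
  have hR : AnalyticOnNhd ℂ (fun r : ℂ => r ^ (-(β : ℂ)) * Real.Gamma β) {z | 0 < z.re} := by
    refine DifferentiableOn.analyticOnNhd (fun z hz => ?_) hopen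
    have : z ∈ Complex.slitPlane := Or.inl hz
    exact ((differentiableAt_id.cpow_const this).mul_const _).differentiableWithinAt
  refine hL.eqOn_of_preconnected_of_frequently_eq hR
    (convex_halfSpace_re_gt 0).isPreconnected (z₀ := 1) (by simp) ?_ hr
  -- The real points greater than `1` accumulate at `1`.
  have ht : Filter.Tendsto (fun x : ℝ => (x : ℂ)) (nhdsWithin 1 (Ioi 1))
      (nhdsWithin (1 : ℂ) {1}ᶜ) := by
    refine tendsto_nhdsWithin_iff.2 ⟨?_, ?_⟩
    · simpa using! (Complex.continuous_ofReal.tendsto (1 : ℝ)).mono_left nhdsWithin_le_nhds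
    · filter_upwards [self_mem_nhdsWithin] with x (hx : 1 < x)
      simpa using hx.ne'
  refine ht.frequently (Filter.Eventually.frequently ?_)
  filter_upwards [self_mem_nhdsWithin] with x (hx : 1 < x)
  have hx0 : 0 < x := by linarith
  have h1 : ∀ t : ℝ, ((t ^ (β - 1) : ℝ) : ℂ) * Complex.exp (-((x : ℂ) * t))
      = ((t ^ (β - 1) * Real.exp (-(x * t)) : ℝ) : ℂ) := fun t => by push_cast; rfl
  simp only [h1]
  rw [integral_complex_ofReal, Real.integral_rpow_mul_exp_neg_mul_Ioi hβ hx0, one_div,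
    Real.inv_rpow hx0.le, ← Real.rpow_neg hx0.le, Complex.ofReal_mul, Complex.ofReal_cpow hx0.le]
  simp

/-! ### Fourier transform of the power kernel, by damping -/

/-- The kernel `t ^ (β - 1) * exp (-ε t)` of a damped fractional integral, extended by zero. -/
def dampedKernel (β ε : ℝ) : ℝ → ℂ :=
  (Ioi (0 : ℝ)).indicator fun t => ((t ^ (β - 1) : ℝ) : ℂ) * Complex.exp (-((ε : ℂ) * t))

theorem integrable_dampedKernel {β ε : ℝ} (hβ : 0 < β) (hε : 0 < ε) :
    Integrable (dampedKernel β ε) :=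
  (integrable_indicator_iff measurableSet_Ioi).2
    (integrableOn_rpow_mul_cexp (by linarith) (by simpa using hε))

theorem fourier_dampedKernel {β ε : ℝ} (hβ : 0 < β) (hε : 0 < ε) (ξ : ℝ) :
    𝓕 (dampedKernel β ε) ξ
      = (ε + 2 * Real.pi * Complex.I * ξ) ^ (-(β : ℂ)) * Real.Gamma β := by
  rw [← laplace_rpow hβ (by simpa using hε), Real.fourier_real_eq_integral_exp_smul,
    ← integral_indicator measurableSet_Ioi]
  congr 1 with t
  by_cases ht : t ∈ Ioi (0 : ℝ)
  · simp only [dampedKernel, indicator_of_mem ht, smul_eq_mul]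
    rw [mul_left_comm, ← Complex.exp_add]
    congr 2
    push_cast
    ring
  · simp [dampedKernel, indicator_of_notMem ht]

theorem integral_fourier_mul_eq {f g : ℝ → ℂ} (hf : Integrable f) (hg : Integrable g) :
    ∫ x, 𝓕 f x * g x = ∫ x, f x * 𝓕 g x := by
  simpa using! VectorFourier.integral_fourierIntegral_smul_eq_flip (L := innerₗ ℝ)
    Real.continuous_fourierChar continuous_inner hf hg

/-- A majorant uniform in the damping `ε`: the imaginary part alone bounds the modulus below, and
the exponent is real, so the argument contributes nothing to the norm. -/
theorem norm_cpow_neg_ofReal_le {β : ℝ} (hβ : 0 < β) (ε : ℝ) {ξ : ℝ} (hξ : ξ ≠ 0) :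
    ‖((ε : ℂ) + 2 * Real.pi * Complex.I * ξ) ^ (-(β : ℂ))‖ ≤ |ξ| ^ (-β) := by
  have him : ((ε : ℂ) + 2 * Real.pi * Complex.I * ξ).im = 2 * Real.pi * ξ := by simp
  have hle : |ξ| ≤ ‖(ε : ℂ) + 2 * Real.pi * Complex.I * ξ‖ := by
    refine le_trans ?_ (Complex.abs_im_le_norm _)
    rw [him, abs_mul, abs_of_pos Real.two_pi_pos]
    nlinarith [abs_nonneg ξ, Real.pi_gt_three]
  have hpos : 0 < |ξ| := abs_pos.2 hξ
  rw [← Complex.ofReal_neg, Complex.norm_cpow_of_ne_zero (norm_pos_iff.1 (hpos.trans_le hle))]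
  simp only [Complex.ofReal_re, Complex.ofReal_im, mul_zero, Real.exp_zero, div_one]
  exact Real.rpow_le_rpow_of_nonpos hpos hle (by linarith)

/-- The Fourier transform of `t ^ (β - 1) / Γ(β)` on the half-line is `(2πiξ) ^ (-β)`. -/
theorem integral_rpow_mul_fourier {β : ℝ} (hβ : 0 < β) {G : ℝ → ℂ} (hG : Integrable G)
    (hG' : Integrable fun ξ => |ξ| ^ (-β) * ‖G ξ‖)
    (hFG : IntegrableOn (fun t : ℝ => ((t ^ (β - 1) : ℝ) : ℂ) * 𝓕 G t) (Ioi 0)) :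
    ∫ t in Ioi (0 : ℝ), ((t ^ (β - 1) : ℝ) : ℂ) * 𝓕 G t
      = Real.Gamma β * ∫ ξ : ℝ, (2 * Real.pi * Complex.I * ξ : ℂ) ^ (-(β : ℂ)) * G ξ := by
  have hae : ∀ᵐ ξ : ℝ, ξ ≠ 0 := by simp [ae_iff]
  have h1 : Filter.Tendsto (fun ε : ℝ => ∫ t, dampedKernel β ε t * 𝓕 G t)
      (nhdsWithin 0 (Ioi 0)) (nhds (∫ t in Ioi (0 : ℝ), ((t ^ (β - 1) : ℝ) : ℂ) * 𝓕 G t)) := by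
    have he : ∀ ε : ℝ, ∫ t, dampedKernel β ε t * 𝓕 G t = ∫ t in Ioi (0 : ℝ),
        Complex.exp (-((ε : ℂ) * t)) * (((t ^ (β - 1) : ℝ) : ℂ) * 𝓕 G t) := fun ε => by
      rw [← integral_indicator measurableSet_Ioi]
      congr 1 with t
      by_cases ht : t ∈ Ioi (0 : ℝ)
      · simp only [dampedKernel, indicator_of_mem ht]; ring
      · simp [dampedKernel, indicator_of_notMem ht]
    simp only [he]
    refine tendsto_integral_filter_of_dominated_convergence _ ?_ ?_ hFG.norm ?_
    · refine Filter.Eventually.of_forall fun ε => ?_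
      exact AEStronglyMeasurable.mul (by fun_prop) hFG.aestronglyMeasurable
    · filter_upwards [self_mem_nhdsWithin] with ε (hε : 0 < ε)
      filter_upwards [ae_restrict_mem measurableSet_Ioi] with t (ht : 0 < t)
      rw [norm_mul, norm_cexp_neg_mul_ofReal]
      refine mul_le_of_le_one_left (norm_nonneg _) (Real.exp_le_one_iff.2 ?_)
      simpa using (mul_pos hε ht).le
    · refine Filter.Eventually.of_forall fun t => ?_
      have hc : Continuous fun ε : ℝ =>
          Complex.exp (-((ε : ℂ) * t)) * (((t ^ (β - 1) : ℝ) : ℂ) * 𝓕 G t) := by fun_prop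
      simpa using (hc.tendsto 0).mono_left nhdsWithin_le_nhds
  have h2 : Filter.Tendsto
      (fun ε : ℝ => ∫ ξ : ℝ, ((ε : ℂ) + 2 * Real.pi * Complex.I * ξ) ^ (-(β : ℂ)) * G ξ)
      (nhdsWithin 0 (Ioi 0))
      (nhds (∫ ξ : ℝ, (2 * Real.pi * Complex.I * ξ : ℂ) ^ (-(β : ℂ)) * G ξ)) := by
    refine tendsto_integral_filter_of_dominated_convergence _ ?_ ?_ hG' ?_
    · refine Filter.Eventually.of_forall fun ε => ?_
      refine AEStronglyMeasurable.mul (Measurable.aestronglyMeasurable ?_) hG.aestronglyMeasurable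
      exact Measurable.pow_const (by fun_prop) _
    · refine Filter.Eventually.of_forall fun ε => ?_
      filter_upwards [hae] with ξ hξ
      rw [norm_mul]
      gcongr
      exact norm_cpow_neg_ofReal_le hβ ε hξ
    · filter_upwards [hae] with ξ hξ
      refine Filter.Tendsto.mul_const _ ?_
      have hs : ((0 : ℝ) : ℂ) + 2 * Real.pi * Complex.I * ξ ∈ Complex.slitPlane := by
        right; simp [hξ, Real.pi_ne_zero]
      have hc : ContinuousAt
          (fun ε : ℝ => ((ε : ℂ) + 2 * Real.pi * Complex.I * ξ) ^ (-(β : ℂ))) 0 :=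
        ContinuousAt.cpow (by fun_prop) continuousAt_const hs
      simpa using! hc.tendsto.mono_left nhdsWithin_le_nhds
  -- For `ε > 0` the kernel is integrable and the multiplication formula equates the two sides up to
  -- the factor `Γ(β)`. Both have limits as the damping is removed.
  refine tendsto_nhds_unique h1 (Filter.Tendsto.congr' ?_ (h2.const_mul _))
  filter_upwards [self_mem_nhdsWithin] with ε (hε : 0 < ε)
  rw [← integral_fourier_mul_eq (integrable_dampedKernel hβ hε) hG, ← integral_const_mul]
  congr 1 with ξ
  rw [fourier_dampedKernel hβ hε]
  ring

/-! ### Fourier multipliers of the derivatives of the fractional integrals -/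

/-- The symbol of the derivative of the left (`e = 1`) or right (`e = -1`) fractional integral of
order `β`, divided by `|ξ| ^ (1 - β)`. -/
def fracSymbol (β e ξ : ℝ) : ℂ :=
  e * ((2 * Real.pi) ^ (1 - β) : ℝ) *
    Complex.exp ((Real.pi * (1 - β) / 2 * Real.sign (e * ξ) : ℝ) * Complex.I)

/-- The principal logarithm of `±I` is `±iπ/2`, and a positive real factor splits off the logarithm
additively. -/
theorem two_pi_I_mul_cpow (β : ℝ) {η : ℝ} (hη : η ≠ 0) :
    (2 * Real.pi * Complex.I * η : ℂ) ^ ((1 - β : ℝ) : ℂ)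
      = ((2 * Real.pi) ^ (1 - β) : ℝ) * (|η| ^ (1 - β) : ℝ) *
        Complex.exp ((Real.pi * (1 - β) / 2 * Real.sign η : ℝ) * Complex.I) := by
  have h2 := Real.two_pi_pos
  have hpos : 0 < 2 * Real.pi * |η| := mul_pos h2 (abs_pos.2 hη)
  have key : ∀ z : ℂ, z ≠ 0 → Complex.log z = (Real.pi / 2 * Real.sign η : ℝ) * Complex.I →
      ((2 * Real.pi * |η| : ℝ) * z) ^ ((1 - β : ℝ) : ℂ)
      = ((2 * Real.pi) ^ (1 - β) : ℝ) * (|η| ^ (1 - β) : ℝ) *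
        Complex.exp ((Real.pi * (1 - β) / 2 * Real.sign η : ℝ) * Complex.I) := by
    intro z hz hl
    rw [Complex.cpow_def_of_ne_zero (mul_ne_zero (by exact_mod_cast hpos.ne') hz),
      Complex.log_ofReal_mul hpos hz, hl, ← Complex.ofReal_mul,
      ← Real.mul_rpow h2.le (abs_nonneg η), Real.rpow_def_of_pos hpos, Complex.ofReal_exp,
      ← Complex.exp_add]
    congr 1
    push_cast
    ring
  rcases lt_or_gt_of_ne hη with h | h
  · rw [← key (-Complex.I) (neg_ne_zero.2 Complex.I_ne_zero)
      (by rw [Complex.log_neg_I, Real.sign_of_neg h]; push_cast; ring), abs_of_neg h]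
    congr 1
    push_cast
    ring
  · rw [← key Complex.I Complex.I_ne_zero
      (by rw [Complex.log_I, Real.sign_of_pos h]; push_cast; ring), abs_of_pos h]
    congr 1
    push_cast
    ring

theorem cpow_mul_two_pi_I (β : ℝ) {e : ℝ} (he : e = 1 ∨ e = -1) {ξ : ℝ} (hξ : ξ ≠ 0) :
    (2 * Real.pi * Complex.I * (e * ξ : ℝ) : ℂ) ^ (-(β : ℂ)) * (2 * Real.pi * Complex.I * ξ)
      = fracSymbol β e ξ * (|ξ| ^ (1 - β) : ℝ) := by
  have he2 : e * e = 1 := by rcases he with rfl | rfl <;> norm_num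
  have hea : |e| = 1 := by rcases he with rfl | rfl <;> norm_num
  have heξ : e * ξ ≠ 0 := mul_ne_zero (fun h => by simp [h] at he2) hξ
  have hz : (2 * Real.pi * Complex.I * (e * ξ : ℝ) : ℂ) ≠ 0 := by
    simp [Real.pi_ne_zero, Complex.I_ne_zero, hξ, (mul_ne_zero_iff.1 heξ).1]
  have h := two_pi_I_mul_cpow β heξ
  rw [show ((1 - β : ℝ) : ℂ) = -(β : ℂ) + 1 by push_cast; ring, Complex.cpow_add _ _ hz,
    Complex.cpow_one, abs_mul, hea, one_mul] at h
  -- As `e² = 1`, the derivative supplies the factor that raises the exponent from `-β` to `1 - β`,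
  -- up to the sign `e` kept in `fracSymbol`.
  have hξe : (2 * Real.pi * Complex.I * ξ : ℂ) = e * (2 * Real.pi * Complex.I * (e * ξ : ℝ)) := by
    have : (e : ℂ) * e = 1 := by exact_mod_cast he2
    push_cast
    linear_combination -(2 * Real.pi * Complex.I * ξ : ℂ) * this
  rw [hξe, mul_left_comm, h, fracSymbol]
  ring

theorem measurable_sign : Measurable Real.sign := by
  unfold Real.sign
  exact Measurable.ite measurableSet_Iio measurable_const
    (Measurable.ite measurableSet_Ioi measurable_const measurable_const)

theorem measurable_fracSymbol (β e : ℝ) : Measurable (fracSymbol β e) := by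
  unfold fracSymbol
  have h : Measurable fun ξ : ℝ => Real.sign (e * ξ) :=
    measurable_sign.comp (measurable_const.mul measurable_id)
  fun_prop

theorem norm_fracSymbol (β : ℝ) {e : ℝ} (he : e = 1 ∨ e = -1) (ξ : ℝ) :
    ‖fracSymbol β e ξ‖ = (2 * Real.pi) ^ (1 - β) := by
  have hea : |e| = 1 := by rcases he with rfl | rfl <;> norm_num
  rw [fracSymbol, norm_mul, norm_mul, Complex.norm_exp_ofReal_mul_I, Complex.norm_real,
    Complex.norm_real, Real.norm_eq_abs, hea,
    Real.norm_of_nonneg (Real.rpow_nonneg Real.two_pi_pos.le _)]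
  ring

/-- The phases are opposite and differ by `π(1 - β)` in absolute value, and the right-hand
derivative carries a sign `-1`; thus `-cos(π(1 - β)) = cos(πβ)` appears for both signs of `ξ`. This
is the source of coercivity. -/
theorem re_conj_fracSymbol_mul (β : ℝ) {ξ : ℝ} (hξ : ξ ≠ 0) :
    ((starRingEnd ℂ) (fracSymbol β 1 ξ) * fracSymbol β (-1) ξ).re
      = Real.cos (Real.pi * β) * ((2 * Real.pi) ^ (1 - β)) ^ 2 := by
  have hs : Real.sign ξ = 1 ∨ Real.sign ξ = -1 := by
    rcases lt_or_gt_of_ne hξ with h | h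
    · exact Or.inr (Real.sign_of_neg h)
    · exact Or.inl (Real.sign_of_pos h)
  have hneg : Real.sign (-1 * ξ) = -Real.sign ξ := by rw [neg_one_mul, Real.sign_neg]
  have hc : Real.cos (Real.pi * β) = -Real.cos (Real.pi * (1 - β) * Real.sign ξ) := by
    rcases hs with h | h
    · rw [h, mul_one, mul_sub, mul_one, Real.cos_pi_sub, neg_neg]
    · rw [h, mul_neg, mul_one, Real.cos_neg, mul_sub, mul_one, Real.cos_pi_sub, neg_neg]
  rw [fracSymbol, fracSymbol, hneg, one_mul, hc]
  simp only [map_mul, Complex.conj_ofReal, ← Complex.exp_conj, Complex.conj_I]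
  rw [show ∀ a b c d : ℂ, ((1 : ℝ) : ℂ) * a * b * (((-1 : ℝ) : ℂ) * c * d) = -(a * c) * (b * d) by
    intros; push_cast; ring, ← Complex.exp_add,
    show (((Real.pi * (1 - β) / 2 * Real.sign ξ : ℝ) : ℂ) * -Complex.I
      + ((Real.pi * (1 - β) / 2 * -Real.sign ξ : ℝ) : ℂ) * Complex.I)
      = ((-(Real.pi * (1 - β) * Real.sign ξ) : ℝ) : ℂ) * Complex.I by push_cast; ring,
    ← Complex.ofReal_mul, ← Complex.ofReal_neg, Complex.re_ofReal_mul,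
    Complex.exp_ofReal_mul_I_re, Real.cos_neg]
  ring

theorem memLp_fracSymbol (β : ℝ) {e : ℝ} (he : e = 1 ∨ e = -1) :
    MemLp (fracSymbol β e) ⊤ (volume : Measure ℝ) :=
  memLp_top_of_bound (measurable_fracSymbol β e).aestronglyMeasurable _
    (Filter.Eventually.of_forall fun ξ => (norm_fracSymbol β he ξ).le)

/-- The Fourier multiplier operator on `L²(ℝ)` that sends `|ξ| ^ (1 - β) 𝓕 w` to the derivative of
the left (`e = 1`) or right (`e = -1`) fractional integral of `w` of order `β`. -/
def fracDeriv (β : ℝ) {e : ℝ} (he : e = 1 ∨ e = -1) :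
    Lp ℂ 2 (volume : Measure ℝ) →L[ℂ] Lp ℂ 2 (volume : Measure ℝ) :=
  ((Lp.fourierTransformₗᵢ ℝ ℂ).symm : Lp ℂ 2 (volume : Measure ℝ) →L[ℂ] _) ∘L
    (ContinuousLinearMap.mul ℂ ℂ).holderL volume ⊤ 2 2 (memLp_fracSymbol β he).toLp

theorem fourier_fracDeriv (β : ℝ) {e : ℝ} (he : e = 1 ∨ e = -1)
    (g : Lp ℂ 2 (volume : Measure ℝ)) :
    (𝓕 (fracDeriv β he g) : Lp ℂ 2 (volume : Measure ℝ)) =ᵐ[volume]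
      fun ξ => fracSymbol β e ξ * g ξ := by
  have h : 𝓕 (fracDeriv β he g) =
      (ContinuousLinearMap.mul ℂ ℂ).holder 2 (memLp_fracSymbol β he).toLp g :=
    (Lp.fourierTransformₗᵢ ℝ ℂ).apply_symm_apply _
  rw [h]
  filter_upwards [(ContinuousLinearMap.mul ℂ ℂ).coeFn_holder (r := 2)
    (memLp_fracSymbol β he).toLp g, (memLp_fracSymbol β he).coeFn_toLp] with ξ h1 h2
  rw [h1, h2]
  rfl

/-- The symbol has constant modulus, so by Plancherel the operator is a multiple of an isometry. -/
theorem norm_fracDeriv (β : ℝ) {e : ℝ} (he : e = 1 ∨ e = -1)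
    (g : Lp ℂ 2 (volume : Measure ℝ)) :
    ‖fracDeriv β he g‖ = (2 * Real.pi) ^ (1 - β) * ‖g‖ := by
  have hp := Real.rpow_nonneg Real.two_pi_pos.le (1 - β)
  rw [← Lp.norm_fourier_eq, ← Real.norm_of_nonneg hp, ← norm_smul]
  have : ∀ᵐ ξ, ‖(𝓕 (fracDeriv β he g) : Lp ℂ 2 (volume : Measure ℝ)) ξ‖
      = ‖(((2 * Real.pi) ^ (1 - β) : ℝ) • g : Lp ℂ 2 (volume : Measure ℝ)) ξ‖ := by
    filter_upwards [fourier_fracDeriv β he g, Lp.coeFn_smul ((2 * Real.pi) ^ (1 - β) : ℝ) g]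
      with ξ h1 h2
    rw [h1, h2, norm_mul, norm_fracSymbol β he, Pi.smul_apply, norm_smul, Real.norm_of_nonneg hp]
  exact le_antisymm (Lp.norm_le_norm_of_ae_le (this.mono fun _ h => h.le))
    (Lp.norm_le_norm_of_ae_le (this.mono fun _ h => h.ge))

theorem re_inner_fracDeriv (β : ℝ) (g : Lp ℂ 2 (volume : Measure ℝ)) :
    (inner ℂ (fracDeriv β (Or.inl rfl : (1 : ℝ) = 1 ∨ (1 : ℝ) = -1) g)
      (fracDeriv β (Or.inr rfl : (-1 : ℝ) = 1 ∨ (-1 : ℝ) = -1) g)).re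
      = Real.cos (Real.pi * β) * ((2 * Real.pi) ^ (1 - β) * ‖g‖) ^ 2 := by
  have hae : ∀ᵐ ξ : ℝ, ξ ≠ 0 := by simp [ae_iff]
  rw [← Lp.inner_fourier_eq, L2.inner_def]
  change RCLike.re (∫ ξ, inner ℂ _ _ : ℂ) = _
  rw [← integral_re (L2.integrable_inner _ _)]
  have hg : ‖g‖ ^ 2 = ∫ ξ, ‖g ξ‖ ^ 2 := by
    have h : ‖g‖ ^ 2 = RCLike.re (inner ℂ g g) := norm_sq_eq_re_inner g
    rw [h, L2.inner_def, ← integral_re (L2.integrable_inner _ _)]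
    congr 1 with ξ
    exact (norm_sq_eq_re_inner (𝕜 := ℂ) (g ξ)).symm
  rw [mul_pow, hg, ← mul_assoc, ← integral_const_mul]
  refine integral_congr_ae ?_
  filter_upwards [fourier_fracDeriv β (Or.inl rfl : (1 : ℝ) = 1 ∨ (1 : ℝ) = -1) g,
    fourier_fracDeriv β (Or.inr rfl : (-1 : ℝ) = 1 ∨ (-1 : ℝ) = -1) g, hae] with ξ h1 h2 hξ
  rw [h1, h2, ← re_conj_fracSymbol_mul β hξ]
  simp only [RCLike.inner_apply, map_mul]
  have h3 : g ξ * (starRingEnd ℂ) (g ξ) = ((‖g ξ‖ ^ 2 : ℝ) : ℂ) := by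
    rw [Complex.mul_conj, Complex.normSq_eq_norm_sq]
  rw [show fracSymbol β (-1) ξ * g ξ * ((starRingEnd ℂ) (fracSymbol β 1 ξ) * (starRingEnd ℂ) (g ξ))
    = ((‖g ξ‖ ^ 2 : ℝ) : ℂ) * ((starRingEnd ℂ) (fracSymbol β 1 ξ) * fracSymbol β (-1) ξ) by
      rw [← h3]; ring]
  change (_ : ℂ).re = _
  rw [Complex.re_ofReal_mul, mul_comm]

/-! ### Fractional integrals on the line and their adjointness -/

/-- The fractional integral of order `β` on the line, from the left for `e = 1` and from the right
for `e = -1`. -/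
def fracInt (β e : ℝ) (φ : ℝ → ℝ) (x : ℝ) : ℝ :=
  1 / Real.Gamma β * ∫ t in Ioi (0 : ℝ), t ^ (β - 1) * φ (x - e * t)

/-- Measurable and bounded, with bounded support. -/
structure IsBddSupp (φ : ℝ → ℝ) : Prop where
  measurable : Measurable φ
  bound : ∃ C, ∀ x, |φ x| ≤ C
  supp : ∃ R, ∀ x, R < |x| → φ x = 0

theorem IsBddSupp.of_continuous {φ : ℝ → ℝ} (hc : Continuous φ) (hs : HasCompactSupport φ) :
    IsBddSupp φ := by
  obtain ⟨C, hC⟩ := hs.exists_bound_of_continuous hc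
  obtain ⟨R, hR⟩ := hs.isCompact.isBounded.subset_closedBall 0
  refine ⟨hc.measurable, ⟨C, hC⟩, R, fun x hx => ?_⟩
  by_contra h
  have := hR (subset_tsupport φ h)
  rw [mem_closedBall_zero_iff, Real.norm_eq_abs] at this
  linarith

theorem IsBddSupp.integrable {φ : ℝ → ℝ} (hφ : IsBddSupp φ) : Integrable φ := by
  obtain ⟨C, hC⟩ := hφ.bound
  obtain ⟨R, hR⟩ := hφ.supp
  have h : IntegrableOn φ (Icc (-R) R) :=
    Measure.integrableOn_of_bounded (by simp) hφ.measurable.aestronglyMeasurable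
      (Filter.Eventually.of_forall hC)
  refine (integrableOn_iff_integrable_of_support_subset fun x hx => ?_).1 h
  by_contra h'
  refine hx (hR x ?_)
  by_contra! h2
  exact h' (abs_le.1 h2)

theorem integrableOn_rpow_Ioc {β : ℝ} (hβ : 0 < β) (R : ℝ) :
    IntegrableOn (fun t : ℝ => t ^ (β - 1)) (Ioc 0 R) :=
  (intervalIntegral.intervalIntegrable_rpow' (by linarith) : IntervalIntegrable _ volume 0 R).1

/-- The hypothesis of Fubini for the pairings below. Where both factors are nonzero, `t ≤ R + S`, so
only the integrable singularity of `t ^ (β - 1)` at zero matters. -/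
theorem integrable_prod_rpow {β : ℝ} (hβ : 0 < β) {e : ℝ} (he : e = 1 ∨ e = -1) {φ u : ℝ → ℝ}
    (hφ : IsBddSupp φ) (hu : IsBddSupp u) :
    Integrable (fun q : ℝ × ℝ => φ q.1 * (q.2 ^ (β - 1) * u (q.1 - e * q.2)))
      (volume.prod (volume.restrict (Ioi 0))) := by
  obtain ⟨C, hC⟩ := hu.bound
  obtain ⟨R, hR⟩ := hφ.supp
  obtain ⟨S, hS⟩ := hu.supp
  have hC0 : 0 ≤ C := (abs_nonneg _).trans (hC 0)
  have hea : |e| = 1 := by rcases he with rfl | rfl <;> norm_num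
  have hb : Integrable ((Ioc 0 (R + S)).indicator fun t : ℝ => t ^ (β - 1))
      (volume.restrict (Ioi 0)) :=
    ((integrable_indicator_iff measurableSet_Ioc).2 (integrableOn_rpow_Ioc hβ _)).restrict
  refine (hφ.integrable.norm.mul_prod (hb.const_mul C)).mono' ?_ ?_
  · refine Measurable.aestronglyMeasurable ?_
    have h1 : Measurable fun t : ℝ => t ^ (β - 1) := measurable_id.pow_const _
    exact (hφ.measurable.comp measurable_fst).mul
      ((h1.comp measurable_snd).mul (hu.measurable.comp (by fun_prop)))
  · have hae : ∀ᵐ q : ℝ × ℝ ∂(volume.prod (volume.restrict (Ioi 0))), 0 < q.2 :=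
      Measure.quasiMeasurePreserving_snd.ae (ae_restrict_mem measurableSet_Ioi)
    filter_upwards [hae] with q hq
    have h0 : 0 ≤ q.2 ^ (β - 1) := Real.rpow_nonneg hq.le _
    rw [norm_mul]
    by_cases hz : φ q.1 = 0
    · simp [hz]
    refine mul_le_mul_of_nonneg_left ?_ (norm_nonneg _)
    by_cases hz' : u (q.1 - e * q.2) = 0
    · rw [hz']
      simp only [mul_zero, norm_zero]
      exact mul_nonneg hC0 (indicator_nonneg (fun t ht => Real.rpow_nonneg ht.1.le _) _)
    have h1 : |q.1| ≤ R := by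
      by_contra! h; exact hz (hR _ h)
    have h2 : |q.1 - e * q.2| ≤ S := by
      by_contra! h; exact hz' (hS _ h)
    have h3 : q.2 ≤ R + S := by
      have := abs_sub q.1 (q.1 - e * q.2)
      rw [sub_sub_cancel, abs_mul, hea, one_mul, abs_of_pos hq] at this
      linarith
    rw [indicator_of_mem (show q.2 ∈ Ioc 0 (R + S) from ⟨hq, h3⟩), norm_mul,
      Real.norm_of_nonneg h0, mul_comm]
    gcongr
    exact hC _

theorem integral_mul_fracInt {β : ℝ} (hβ : 0 < β) {e : ℝ} (he : e = 1 ∨ e = -1) {φ u : ℝ → ℝ}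
    (hφ : IsBddSupp φ) (hu : IsBddSupp u) :
    ∫ s, φ s * fracInt β e u s
      = 1 / Real.Gamma β * ∫ t in Ioi (0 : ℝ), t ^ (β - 1) * ∫ s, φ s * u (s - e * t) := by
  have h := integral_integral_swap (f := fun s t => φ s * (t ^ (β - 1) * u (s - e * t)))
    (integrable_prod_rpow hβ he hφ hu)
  rw [show (∫ s, φ s * fracInt β e u s) = 1 / Real.Gamma β *
    ∫ s, ∫ t in Ioi (0 : ℝ), φ s * (t ^ (β - 1) * u (s - e * t)) by
      rw [← integral_const_mul]
      congr 1 with s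
      rw [fracInt, integral_const_mul]
      ring, h]
  congr 2 with t
  rw [← integral_const_mul]
  congr 1 with s
  ring

/-- The left and right fractional integrals are adjoint to each other. -/
theorem integral_fracInt_mul {β : ℝ} (hβ : 0 < β) {e : ℝ} (he : e = 1 ∨ e = -1) {φ u : ℝ → ℝ}
    (hφ : IsBddSupp φ) (hu : IsBddSupp u) :
    ∫ x, fracInt β e φ x * u x = ∫ s, φ s * fracInt β (-e) u s := by
  have he' : -e = 1 ∨ -e = -1 := by rcases he with rfl | rfl <;> norm_num
  rw [integral_mul_fracInt hβ he' hφ hu]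
  simp only [mul_comm (fracInt β e φ _)]
  rw [integral_mul_fracInt hβ he hu hφ]
  congr 2 with t
  congr 1
  -- Translation invariance moves the shift onto the other factor with the opposite sign.
  rw [← integral_add_right_eq_self _ (e * t)]
  congr 1 with s
  rw [add_sub_cancel_right, mul_comm, neg_mul, sub_neg_eq_add]

theorem integrableOn_rpow_mul_of_isBddSupp {β : ℝ} (hβ : 0 < β) {u : ℝ → ℝ} (hu : IsBddSupp u) :
    IntegrableOn (fun t : ℝ => t ^ (β - 1) * u t) (Ioi 0) := by
  obtain ⟨C, hC⟩ := hu.bound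
  obtain ⟨S, hS⟩ := hu.supp
  have h1 : IntegrableOn (fun t : ℝ => t ^ (β - 1) * u t) (Ioc 0 S) :=
    Integrable.mul_bdd (c := C) (integrableOn_rpow_Ioc hβ S) hu.measurable.aestronglyMeasurable
      (Filter.Eventually.of_forall hC)
  refine h1.of_forall_sdiff_eq_zero measurableSet_Ioi fun t ht => ?_
  have ht0 : 0 < t := ht.1
  rw [hS t, mul_zero]
  by_contra! h
  exact ht.2 ⟨ht0, by rwa [abs_of_pos ht0] at h⟩

/-! ### The weak derivative of the fractional integral of a smooth function -/

/-- A smooth compactly supported real function as a complex Schwartz function. -/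
def toSchwartz {v : ℝ → ℝ} (hv : ContDiff ℝ ∞ v) (hs : HasCompactSupport v) :
    SchwartzMap ℝ ℂ :=
  HasCompactSupport.toSchwartzMap (f := fun x => (v x : ℂ))
    (hs.comp_left (g := Complex.ofReal) Complex.ofReal_zero)
    (Complex.ofRealCLM.contDiff.comp hv)

theorem toSchwartz_apply {v : ℝ → ℝ} (hv : ContDiff ℝ ∞ v) (hs : HasCompactSupport v) (x : ℝ) :
    toSchwartz hv hs x = v x := rfl

theorem fourier_toSchwartz {v : ℝ → ℝ} (hv : ContDiff ℝ ∞ v) (hs : HasCompactSupport v) (ξ : ℝ) :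
    𝓕 (toSchwartz hv hs) ξ = 𝓕 (fun x => (v x : ℂ)) ξ := rfl

theorem fourier_ofReal_deriv {v : ℝ → ℝ} (hv : ContDiff ℝ ∞ v) (hs : HasCompactSupport v) (ξ : ℝ) :
    𝓕 (fun x => ((deriv v x : ℝ) : ℂ)) ξ
      = 2 * Real.pi * Complex.I * ξ * 𝓕 (fun x => (v x : ℂ)) ξ := by
  have hd : ∀ x, HasDerivAt (fun x => (v x : ℂ)) (deriv v x : ℝ) x := fun x =>
    ((hv.differentiable (by simp)) x).hasDerivAt.ofReal_comp
  have hde : deriv (fun x => (v x : ℂ)) = fun x => ((deriv v x : ℝ) : ℂ) :=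
    funext fun x => (hd x).deriv
  have h := Real.fourier_deriv (f := fun x => (v x : ℂ))
    (hv.continuous.integrable_of_hasCompactSupport hs).ofReal (fun x => (hd x).differentiableAt)
    (by rw [hde]
        exact ((hv.continuous_deriv (by simp)).integrable_of_hasCompactSupport hs.deriv).ofReal)
  rw [hde] at h
  exact congrFun h ξ

/-- The function whose Fourier transform is the correlation of `w` with the derivative of `v`. -/
def crossSpectrum (w v : ℝ → ℝ) (ξ : ℝ) : ℂ :=
  (starRingEnd ℂ) (𝓕 (fun x => ((deriv v x : ℝ) : ℂ)) ξ) * 𝓕 (fun x => (w x : ℂ)) ξ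

theorem fourier_comp_add {f : ℝ → ℂ} (t ξ : ℝ) :
    𝓕 (fun x => f (x + t)) ξ = Complex.exp (2 * Real.pi * t * ξ * Complex.I) * 𝓕 f ξ := by
  rw [Real.fourier_real_eq_integral_exp_smul, Real.fourier_real_eq_integral_exp_smul,
    ← integral_add_right_eq_self (fun v : ℝ =>
      Complex.exp (((-2 * Real.pi * v * ξ : ℝ) : ℂ) * Complex.I) • f v) t, ← integral_const_mul]
  congr 1 with x
  rw [smul_eq_mul, smul_eq_mul, ← mul_assoc, ← Complex.exp_add]
  congr 2
  push_cast
  ring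

/-- Plancherel for `w` and the translate of `deriv v`; the translation becomes the Fourier phase. -/
theorem fourier_crossSpectrum {w v : ℝ → ℝ} (hw : ContDiff ℝ ∞ w) (hws : HasCompactSupport w)
    (hv : ContDiff ℝ ∞ v) (hvs : HasCompactSupport v) (t : ℝ) :
    𝓕 (crossSpectrum w v) t = ((∫ s, w s * deriv v (s + t) : ℝ) : ℂ) := by
  have hv' : ContDiff ℝ ∞ (deriv v) := (contDiff_infty_iff_deriv.1 hv).2
  have hd : ContDiff ℝ ∞ fun s => deriv v (s + t) := hv'.comp (contDiff_id.add contDiff_const)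
  have hds : HasCompactSupport fun s => deriv v (s + t) :=
    hvs.deriv.comp_homeomorph (Homeomorph.addRight t)
  have h := SchwartzMap.integral_inner_fourier_fourier (toSchwartz hd hds) (toSchwartz hw hws)
  simp only [RCLike.inner_apply, toSchwartz_apply, fourier_toSchwartz, Complex.conj_ofReal] at h
  rw [← integral_complex_ofReal, Real.fourier_real_eq_integral_exp_smul]
  simp only [Complex.ofReal_mul]
  rw [← h]
  congr 1 with ξ
  rw [fourier_comp_add (f := fun x => ((deriv v x : ℝ) : ℂ)), crossSpectrum, map_mul,
    ← Complex.exp_conj, smul_eq_mul]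
  simp only [map_mul, Complex.conj_ofReal, Complex.conj_I, map_ofNat]
  rw [show ((-2 : ℝ) : ℂ) * Real.pi * ξ * t * Complex.I = 2 * Real.pi * t * ξ * -Complex.I by
    push_cast; ring]
  ring

section CrossSpectrum

variable {w v : ℝ → ℝ}

theorem continuous_fourier_ofReal (hv : ContDiff ℝ ∞ v) (hvs : HasCompactSupport v) :
    Continuous (𝓕 fun x => (v x : ℂ)) :=
  (𝓕 (toSchwartz hv hvs)).continuous

theorem integrable_fourier_ofReal (hv : ContDiff ℝ ∞ v) (hvs : HasCompactSupport v) :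
    Integrable (𝓕 fun x => (v x : ℂ)) :=
  (𝓕 (toSchwartz hv hvs)).integrable

theorem exists_norm_fourier_ofReal_le (hv : ContDiff ℝ ∞ v) (hvs : HasCompactSupport v) :
    ∃ C, ∀ ξ, ‖𝓕 (fun x => (v x : ℂ)) ξ‖ ≤ C :=
  ⟨_, (𝓕 (toSchwartz hv hvs)).toBoundedContinuousFunction.norm_coe_le_norm⟩

theorem contDiff_deriv (hv : ContDiff ℝ ∞ v) : ContDiff ℝ ∞ (deriv v) :=
  (contDiff_infty_iff_deriv.1 hv).2

theorem continuous_crossSpectrum (hw : ContDiff ℝ ∞ w) (hws : HasCompactSupport w)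
    (hv : ContDiff ℝ ∞ v) (hvs : HasCompactSupport v) : Continuous (crossSpectrum w v) :=
  (Complex.continuous_conj.comp (continuous_fourier_ofReal (contDiff_deriv hv) hvs.deriv)).mul
    (continuous_fourier_ofReal hw hws)

theorem integrable_crossSpectrum (hw : ContDiff ℝ ∞ w) (hws : HasCompactSupport w)
    (hv : ContDiff ℝ ∞ v) (hvs : HasCompactSupport v) : Integrable (crossSpectrum w v) := by
  obtain ⟨C, hC⟩ := exists_norm_fourier_ofReal_le hw hws
  refine ((integrable_fourier_ofReal (contDiff_deriv hv) hvs.deriv).norm.mul_const C).mono'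
    (continuous_crossSpectrum hw hws hv hvs).aestronglyMeasurable
    (Filter.Eventually.of_forall fun ξ => ?_)
  rw [crossSpectrum, norm_mul, RCLike.norm_conj]
  gcongr
  exact hC ξ

/-- The derivative of `v` contributes a factor `|ξ|`, which absorbs the singularity at the origin:
`|ξ| ^ (1 - β) ≤ 1 + |ξ|`. The remaining decay comes from rapidly decreasing transforms. -/
theorem integrable_rpow_mul_norm_crossSpectrum (hw : ContDiff ℝ ∞ w) (hws : HasCompactSupport w)
    (hv : ContDiff ℝ ∞ v) (hvs : HasCompactSupport v)
    {β : ℝ} (hβ : 0 < β) (hβ1 : β < 1) :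
    Integrable fun ξ => |ξ| ^ (-β) * ‖crossSpectrum w v ξ‖ := by
  have hae : ∀ᵐ ξ : ℝ, ξ ≠ 0 := by simp [ae_iff]
  obtain ⟨C, hC⟩ := exists_norm_fourier_ofReal_le hw hws
  refine ((((integrable_fourier_ofReal hv hvs).norm.const_mul (2 * Real.pi)).add
    (integrable_fourier_ofReal (contDiff_deriv hv) hvs.deriv).norm).mul_const C).mono' ?_ ?_
  · refine AEStronglyMeasurable.mul (Measurable.aestronglyMeasurable ?_)
      (continuous_crossSpectrum hw hws hv hvs).norm.aestronglyMeasurable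
    exact Measurable.pow_const (by fun_prop) _
  · filter_upwards [hae] with ξ hξ
    have hpos : 0 < |ξ| := abs_pos.2 hξ
    have h0 := Real.rpow_nonneg hpos.le (-β)
    have h1 : |ξ| ^ (-β) * |ξ| ≤ 1 + |ξ| := by
      rw [← Real.rpow_add_one hpos.ne']
      rcases le_total |ξ| 1 with h | h
      · have := Real.rpow_le_one hpos.le h (by linarith : 0 ≤ -β + 1)
        linarith
      · have := Real.rpow_le_rpow_of_exponent_le h (by linarith : -β + 1 ≤ 1)
        rw [Real.rpow_one] at this
        linarith
    have h2 : ‖𝓕 (fun x => ((deriv v x : ℝ) : ℂ)) ξ‖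
        = 2 * Real.pi * |ξ| * ‖𝓕 (fun x => (v x : ℂ)) ξ‖ := by
      rw [fourier_ofReal_deriv hv hvs]
      simp [abs_of_pos Real.pi_pos]
    rw [norm_mul, norm_norm, Real.norm_of_nonneg h0, crossSpectrum, norm_mul, RCLike.norm_conj,
      ← mul_assoc, Pi.add_apply]
    refine mul_le_mul ?_ (hC ξ) (norm_nonneg _) (by positivity)
    rw [h2]
    calc _ = 2 * Real.pi * ‖𝓕 (fun x => (v x : ℂ)) ξ‖ * (|ξ| ^ (-β) * |ξ|) := by ring
      _ ≤ 2 * Real.pi * ‖𝓕 (fun x => (v x : ℂ)) ξ‖ * (1 + |ξ|) := by gcongr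
      _ = _ := by ring

end CrossSpectrum

theorem fourier_comp_mul_sign (f : ℝ → ℂ) {e : ℝ} (he : e = 1 ∨ e = -1) (t : ℝ) :
    𝓕 (fun ξ => f (e * ξ)) t = 𝓕 f (e * t) := by
  rcases he with rfl | rfl
  · simp
  · simpa using! Real.fourier_comp_linearIsometry (LinearIsometryEquiv.neg ℝ) f t

theorem integral_comp_mul_sign (f : ℝ → ℂ) {e : ℝ} (he : e = 1 ∨ e = -1) :
    ∫ ξ, f (e * ξ) = ∫ ξ, f ξ := by
  rcases he with rfl | rfl
  · simp
  · simpa using integral_neg_eq_self f volume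

theorem integrable_comp_mul_sign {E : Type*} [NormedAddCommGroup E] {f : ℝ → E} {e : ℝ}
    (he : e = 1 ∨ e = -1) (hf : Integrable f) : Integrable fun ξ => f (e * ξ) := by
  rcases he with rfl | rfl
  · simpa using hf
  · simpa using hf.comp_neg

/-- After Fubini, the inner integral is the Fourier transform of the cross spectrum reflected by
`e`, and `integral_rpow_mul_fourier` applies. The substitution `ξ ↦ e * ξ` moves the reflection into
the power. -/
theorem integral_mul_fracInt_deriv {β : ℝ} (hβ : 0 < β) (hβ1 : β < 1) {e : ℝ}
    (he : e = 1 ∨ e = -1) {w v : ℝ → ℝ} (hw : ContDiff ℝ ∞ w) (hws : HasCompactSupport w)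
    (hv : ContDiff ℝ ∞ v) (hvs : HasCompactSupport v) :
    ((∫ s, w s * fracInt β (-e) (deriv v) s : ℝ) : ℂ)
      = ∫ ξ : ℝ, (2 * Real.pi * Complex.I * (e * ξ : ℝ) : ℂ) ^ (-(β : ℂ))
        * crossSpectrum w v ξ := by
  have he' : -e = 1 ∨ -e = -1 := by rcases he with rfl | rfl <;> norm_num
  have he2 : e * e = 1 := by rcases he with rfl | rfl <;> norm_num
  have hea : |e| = 1 := by rcases he with rfl | rfl <;> norm_num
  have hv' := contDiff_deriv hv
  have hF : ∀ t, 𝓕 (fun ξ => crossSpectrum w v (e * ξ)) t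
      = ((∫ s, w s * deriv v (s - -e * t) : ℝ) : ℂ) := fun t => by
    rw [fourier_comp_mul_sign _ he, fourier_crossSpectrum hw hws hv hvs]
    simp only [neg_mul, sub_neg_eq_add]
  have hprod := integrable_prod_rpow hβ he' (.of_continuous hw.continuous hws)
    (.of_continuous hv'.continuous hvs.deriv)
  have hint : IntegrableOn (fun t : ℝ => ((t ^ (β - 1) : ℝ) : ℂ) *
      𝓕 (fun ξ => crossSpectrum w v (e * ξ)) t) (Ioi 0) := by
    refine hprod.integral_prod_right.ofReal.congr (Filter.Eventually.of_forall fun t => ?_)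
    simp only [hF]
    rw [← Complex.ofReal_mul, ← integral_const_mul]
    congr 2 with s
    ring
  have h := integral_rpow_mul_fourier hβ
    (integrable_comp_mul_sign he (integrable_crossSpectrum hw hws hv hvs))
    (by
      have := integrable_comp_mul_sign he
        (integrable_rpow_mul_norm_crossSpectrum hw hws hv hvs hβ hβ1)
      simpa only [abs_mul, hea, one_mul] using this) hint
  rw [integral_mul_fracInt hβ he' (.of_continuous hw.continuous hws)
    (.of_continuous hv'.continuous hvs.deriv), Complex.ofReal_mul, ← integral_complex_ofReal]
  simp only [Complex.ofReal_mul, ← hF]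
  rw [h, ← mul_assoc, ← Complex.ofReal_mul, one_div_mul_cancel (Real.Gamma_pos_of_pos hβ).ne',
    Complex.ofReal_one, one_mul,
    ← integral_comp_mul_sign (fun ξ : ℝ => (2 * Real.pi * Complex.I * (e * ξ) : ℂ) ^ (-(β : ℂ))
        * crossSpectrum w v ξ) he]
  congr 1 with ξ
  have : (e : ℂ) * ((e * ξ : ℝ) : ℂ) = ξ := by
    rw [← Complex.ofReal_mul, ← mul_assoc, he2, one_mul]
  rw [this]

/-- The multiplier operator gives the distributional derivative of the fractional integral of a
smooth function. -/
theorem integral_fracDeriv_mul {β : ℝ} (hβ : 0 < β) (hβ1 : β < 1) {e : ℝ}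
    (he : e = 1 ∨ e = -1) {w v : ℝ → ℝ} (hw : ContDiff ℝ ∞ w) (hws : HasCompactSupport w)
    (hv : ContDiff ℝ ∞ v) (hvs : HasCompactSupport v) {g : Lp ℂ 2 (volume : Measure ℝ)}
    (hg : g =ᵐ[volume] fun ξ => ((|ξ| ^ (1 - β) : ℝ) : ℂ) * 𝓕 (fun x => (w x : ℂ)) ξ) :
    ∫ x, fracDeriv β he g x * v x = -((∫ s, w s * fracInt β (-e) (deriv v) s : ℝ) : ℂ) := by
  have hae : ∀ᵐ ξ : ℝ, ξ ≠ 0 := by simp [ae_iff]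
  have h1 : ∫ x, fracDeriv β he g x * v x
      = inner ℂ ((toSchwartz hv hvs).toLp 2) (fracDeriv β he g) := by
    rw [L2.inner_def]
    refine integral_congr_ae ?_
    filter_upwards [(toSchwartz hv hvs).coeFn_toLp 2] with x hx
    rw [hx, toSchwartz_apply, RCLike.inner_apply, Complex.conj_ofReal]
  -- Plancherel; the minus sign is that of the conjugate of `2πiξ` inside `crossSpectrum`.
  rw [h1, ← Lp.inner_fourier_eq, SchwartzMap.toLp_fourier_eq, L2.inner_def,
    integral_mul_fracInt_deriv hβ hβ1 he hw hws hv hvs, ← integral_neg]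
  refine integral_congr_ae ?_
  filter_upwards [(𝓕 (toSchwartz hv hvs)).coeFn_toLp 2, fourier_fracDeriv β he g, hg, hae]
    with ξ h2 h3 h4 hξ
  rw [h2, h3, h4, fourier_toSchwartz, RCLike.inner_apply, crossSpectrum,
    fourier_ofReal_deriv hv hvs, map_mul, ← mul_assoc (fracSymbol β e ξ),
    ← cpow_mul_two_pi_I β he hξ]
  simp only [map_mul, Complex.conj_ofReal, Complex.conj_I, map_ofNat]
  ring

/-! ### Embedding of the fractional space in the bounded functions -/

/-- Square integrability holds because `2μ > 1`. The factor `5 ^ μ` makes this function dominate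
`|ξ| ^ (-μ)` for `|ξ| > 1/4`. -/
theorem memLp_one_add_abs_rpow {μ : ℝ} (hμ : 1 / 2 < μ) :
    MemLp (fun ξ : ℝ => 5 ^ μ * (1 + |ξ|) ^ (-μ)) 2 volume := by
  have hm : Measurable fun ξ : ℝ => 5 ^ μ * (1 + |ξ|) ^ (-μ) :=
    (Measurable.pow_const (by fun_prop) _).const_mul _
  rw [memLp_two_iff_integrable_sq hm.aestronglyMeasurable]
  have h : Integrable fun ξ : ℝ => (1 + ‖ξ‖) ^ (-(2 * μ)) :=
    integrable_one_add_norm (by simp; linarith)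
  refine (h.const_mul ((5 ^ μ) ^ 2)).congr (Filter.Eventually.of_forall fun ξ => ?_)
  have h0 : 0 ≤ 1 + |ξ| := by positivity
  simp only [Real.norm_eq_abs]
  rw [mul_pow, ← Real.rpow_natCast ((1 + |ξ|) ^ (-μ)), ← Real.rpow_mul h0]
  congr 2
  push_cast
  ring

theorem integral_mul_norm_le {k : ℝ → ℝ} (hk : MemLp k 2 volume)
    (g : Lp ℂ 2 (volume : Measure ℝ)) : ∫ ξ, k ξ * ‖g ξ‖ ≤ ‖hk.toLp‖ * ‖g‖ := by
  have hgn := (Lp.memLp g).norm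
  have h : ∫ ξ, k ξ * ‖g ξ‖ = inner ℝ hgn.toLp hk.toLp := by
    rw [L2.inner_def]
    refine integral_congr_ae ?_
    filter_upwards [hgn.coeFn_toLp, hk.coeFn_toLp] with ξ h1 h2
    rw [h1, h2]
    rfl
  rw [h, mul_comm]
  refine (real_inner_le_norm _ _).trans (mul_le_mul_of_nonneg_right ?_ (norm_nonneg _))
  refine Lp.norm_le_norm_of_ae_le ?_
  filter_upwards [hgn.coeFn_toLp] with ξ h
  rw [h, norm_norm]

/-- The constant in the embedding of `H^μ_0(0, 1)` in the bounded functions. -/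
def supConst (μ : ℝ) (hμ : 1 / 2 < μ) : ℝ := 2 * ‖(memLp_one_add_abs_rpow hμ).toLp‖

theorem supConst_nonneg {μ : ℝ} (hμ : 1 / 2 < μ) : 0 ≤ supConst μ hμ :=
  mul_nonneg zero_le_two (norm_nonneg _)

/-- Fourier inversion bounds the maximum `M` of `|w|` by the `L¹` norm of its transform. The support
lies in an interval of length one, so the transform is at most `M`, and the frequencies `|ξ| ≤ 1/4`
contribute at most `M / 2`. Cauchy–Schwarz bounds the others by the seminorm. Absorbing `M / 2`
gives the factor `2` in `supConst`, with no `L²` norm of `w` on the right. -/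
theorem IsTestFunction.abs_apply_le {μ : ℝ} (hμ : 1 / 2 < μ) {w : ℝ → ℝ} (hw : IsTestFunction 0 1 w)
    {g : Lp ℂ 2 (volume : Measure ℝ)}
    (hg : g =ᵐ[volume] fun ξ => ((|ξ| ^ μ : ℝ) : ℂ) * 𝓕 (fun x => (w x : ℂ)) ξ) (x : ℝ) :
    |w x| ≤ supConst μ hμ * ‖g‖ := by
  obtain ⟨x₀, hx₀⟩ := hw.smooth.continuous.norm.exists_forall_ge_of_hasCompactSupport
    hw.hasCompactSupport.norm
  simp only [Real.norm_eq_abs] at hx₀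
  have hM0 : 0 ≤ |w x₀| := abs_nonneg _
  have hwint : Integrable w :=
    hw.smooth.continuous.integrable_of_hasCompactSupport hw.hasCompactSupport
  have hsup : ∀ ξ, ‖𝓕 (fun x => (w x : ℂ)) ξ‖ ≤ |w x₀| := fun ξ => by
    refine (VectorFourier.norm_fourierIntegral_le_integral_norm _ _ _ _ _).trans ?_
    have hs : ∀ y ∉ Ioo (0 : ℝ) 1, ‖(w y : ℂ)‖ = 0 := fun y hy => by
      rw [norm_eq_zero, Complex.ofReal_eq_zero]
      by_contra h
      exact hy (hw.tsupport_subset (subset_tsupport w h))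
    rw [← setIntegral_eq_integral_of_forall_compl_eq_zero hs]
    calc ∫ y in Ioo (0 : ℝ) 1, ‖(w y : ℂ)‖ ≤ ∫ y in Ioo (0 : ℝ) 1, |w x₀| :=
          setIntegral_mono hwint.ofReal.norm.integrableOn (by simp) fun y => by
            simpa using hx₀ y
      _ = |w x₀| := by simp
  have hae : ∀ᵐ ξ : ℝ, ξ ≠ 0 := by simp [ae_iff]
  have hF : Integrable fun ξ => ‖𝓕 (fun x => (w x : ℂ)) ξ‖ :=
    (integrable_fourier_ofReal hw.smooth hw.hasCompactSupport).norm
  have hk := memLp_one_add_abs_rpow hμ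
  have hI : Integrable ((Icc (-1 / 4 : ℝ) (1 / 4)).indicator fun _ => |w x₀|) :=
    (integrable_indicator_iff measurableSet_Icc).2 (by simp)
  have hle : ∫ ξ, ‖𝓕 (fun x => (w x : ℂ)) ξ‖
      ≤ |w x₀| / 2 + ‖hk.toLp‖ * ‖g‖ := by
    have h2 : ∫ ξ, (Icc (-1 / 4 : ℝ) (1 / 4)).indicator (fun _ => |w x₀|) ξ = |w x₀| / 2 := by
      rw [integral_indicator measurableSet_Icc, setIntegral_const, Measure.real,
        Real.volume_Icc, ENNReal.toReal_ofReal (by norm_num), smul_eq_mul]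
      ring
    rw [← h2]
    refine le_trans ?_ (add_le_add_right (integral_mul_norm_le hk g) _)
    have hkg : Integrable fun ξ => 5 ^ μ * (1 + |ξ|) ^ (-μ) * ‖g ξ‖ :=
      hk.integrable_mul (Lp.memLp g).norm
    rw [← integral_add hI hkg]
    refine integral_mono_ae hF (hI.add hkg) ?_
    filter_upwards [hg, hae] with ξ h3 h0
    have hpos : 0 < |ξ| := abs_pos.2 h0
    by_cases hξ : ξ ∈ Icc (-1 / 4 : ℝ) (1 / 4)
    · rw [indicator_of_mem hξ]
      have : 0 ≤ 5 ^ μ * (1 + |ξ|) ^ (-μ) * ‖g ξ‖ := by positivity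
      linarith [hsup ξ]
    · rw [indicator_of_notMem hξ, zero_add]
      have h4 : 1 / 4 < |ξ| := by
        by_contra! h
        have := abs_le.1 h
        exact hξ ⟨by linarith [this.1], this.2⟩
      have h5 : |ξ| ^ (-μ) ≤ 5 ^ μ * (1 + |ξ|) ^ (-μ) := by
        have h6 : (5 : ℝ) ^ μ * (1 + |ξ|) ^ (-μ) = ((1 + |ξ|) / 5) ^ (-μ) := by
          rw [Real.div_rpow (by positivity) (by norm_num), Real.rpow_neg (x := 5) (by norm_num),
            div_inv_eq_mul, mul_comm]
        rw [h6]
        exact Real.rpow_le_rpow_of_nonpos (by positivity) (by linarith) (by linarith)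
      have h7 : ‖𝓕 (fun x => (w x : ℂ)) ξ‖ = |ξ| ^ (-μ) * ‖g ξ‖ := by
        rw [h3, norm_mul, Complex.norm_real, Real.norm_of_nonneg (by positivity), ← mul_assoc,
          ← Real.rpow_add hpos, neg_add_cancel, Real.rpow_zero, one_mul]
      rw [h7]
      gcongr
  have hinv : ∀ y, |w y| ≤ ∫ ξ, ‖𝓕 (fun x => (w x : ℂ)) ξ‖ := fun y => by
    set W := toSchwartz hw.smooth hw.hasCompactSupport with hW
    have h8 : (w y : ℂ) = 𝓕⁻ (𝓕 fun x => (w x : ℂ)) y := by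
      have h9 : 𝓕⁻ (𝓕 W) = W := FourierTransform.fourierInv_fourier_eq W
      have h10 := congrArg (fun f : SchwartzMap ℝ ℂ => f y) h9
      simpa only [SchwartzMap.fourierInv_coe, SchwartzMap.fourier_coe] using! h10.symm
    rw [← Real.norm_eq_abs, ← Complex.norm_real, h8, Real.fourierInv_eq_fourier_neg]
    exact VectorFourier.norm_fourierIntegral_le_integral_norm _ _ _ _ _
  have hx := hx₀ x
  have h11 := (hinv x₀).trans hle
  rw [supConst]
  linarith

section HZero

variable {μ : ℝ} {p : PairSpaceLine}

theorem HZero.exists_seq (hp : p ∈ HZero μ 0 1) :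
    ∃ q : ℕ → PairSpaceLine, (∀ n, q n ∈ testGraph μ 0 1) ∧
      Filter.Tendsto q Filter.atTop (nhds p) ∧
      ∀ᵐ x, Filter.Tendsto (fun n => (q n).fst x) Filter.atTop (nhds (p.fst x)) := by
  obtain ⟨q, hq, hlim⟩ := mem_closure_iff_seq_limit.1 hp
  have h1 : Filter.Tendsto (fun n => (q n).fst) Filter.atTop (nhds p.fst) :=
    ((WithLp.continuous_fst 2 _ _).tendsto p).comp hlim
  obtain ⟨ns, hns, h2⟩ := (tendstoInMeasure_of_tendsto_Lp h1).exists_seq_tendsto_ae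
  exact ⟨q ∘ ns, fun n => hq _, hlim.comp hns.tendsto_atTop, h2⟩

theorem HZero.ae_abs_le (hμ : 1 / 2 < μ) (hp : p ∈ HZero μ 0 1) :
    ∀ᵐ x, |p.fst x| ≤ supConst μ hμ * ‖p.snd‖ := by
  obtain ⟨q, hq, hlim, hae⟩ := HZero.exists_seq hp
  have h1 : Filter.Tendsto (fun n => supConst μ hμ * ‖(q n).snd‖) Filter.atTop
      (nhds (supConst μ hμ * ‖p.snd‖)) :=
    ((((WithLp.continuous_snd 2 _ _).tendsto p).comp hlim).norm).const_mul _
  have h2 : ∀ᵐ x, ∀ n, |(q n).fst x| ≤ supConst μ hμ * ‖(q n).snd‖ := by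
    refine ae_all_iff.2 fun n => ?_
    obtain ⟨w, hw, h3, h4⟩ := hq n
    filter_upwards [h3] with x hx
    rw [hx]
    exact hw.abs_apply_le hμ h4 x
  filter_upwards [hae, h2] with x h3 h4
  exact le_of_tendsto_of_tendsto' h3.abs h1 h4

theorem HZero.ae_eq_zero (hp : p ∈ HZero μ 0 1) :
    ∀ᵐ x, x ∉ Ioo (0 : ℝ) 1 → p.fst x = 0 := by
  obtain ⟨q, hq, hlim, hae⟩ := HZero.exists_seq hp
  have h2 : ∀ᵐ x, ∀ n, x ∉ Ioo (0 : ℝ) 1 → (q n).fst x = 0 := by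
    refine ae_all_iff.2 fun n => ?_
    obtain ⟨w, hw, h3, h4⟩ := hq n
    filter_upwards [h3] with x hx hx'
    rw [hx]
    by_contra h
    exact hx' (hw.tsupport_subset (subset_tsupport w h))
  filter_upwards [hae, h2] with x h3 h4 hx
  refine tendsto_nhds_unique h3 ?_
  simp only [h4 _ hx]
  exact tendsto_const_nhds

/-- A bounded measurable representative supported in `(0, 1)`. -/
theorem HZero.exists_isBddSupp (hμ : 1 / 2 < μ) (hp : p ∈ HZero μ 0 1) :
    ∃ ψ : ℝ → ℝ, Measurable ψ ∧ (∀ x, |ψ x| ≤ supConst μ hμ * ‖p.snd‖) ∧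
      (∀ x ∉ Ioo (0 : ℝ) 1, ψ x = 0) ∧ p.fst =ᵐ[volume] ψ := by
  set M := supConst μ hμ * ‖p.snd‖ with hM
  have hM0 : 0 ≤ M := mul_nonneg (supConst_nonneg hμ) (norm_nonneg _)
  refine ⟨(Ioo (0 : ℝ) 1).indicator fun x => max (-M) (min M (p.fst x)), ?_, fun x => ?_,
    fun x hx => indicator_of_notMem hx _, ?_⟩
  · refine Measurable.indicator ?_ measurableSet_Ioo
    exact measurable_const.max (measurable_const.min (Lp.stronglyMeasurable _).measurable)
  · by_cases hx : x ∈ Ioo (0 : ℝ) 1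
    · rw [indicator_of_mem hx]
      exact abs_le.2 ⟨le_max_left _ _, max_le (by linarith) (min_le_left _ _)⟩
    · rw [indicator_of_notMem hx, abs_zero]
      exact hM0
  · filter_upwards [HZero.ae_abs_le hμ hp, HZero.ae_eq_zero hp] with x h1 h2
    by_cases hx : x ∈ Ioo (0 : ℝ) 1
    · rw [indicator_of_mem hx, min_eq_right (abs_le.1 h1).2, max_eq_right (abs_le.1 h1).1]
    · rw [indicator_of_notMem hx, h2 hx]

/-- A Poincaré inequality: on a set of measure one, the `L²` norm is at most the sup bound. -/
theorem HZero.norm_fst_le (hμ : 1 / 2 < μ) (hp : p ∈ HZero μ 0 1) :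
    ‖p.fst‖ ≤ supConst μ hμ * ‖p.snd‖ := by
  have hC : 0 ≤ supConst μ hμ * ‖p.snd‖ := mul_nonneg (supConst_nonneg hμ) (norm_nonneg _)
  have hm : MemLp ((Ioo (0 : ℝ) 1).indicator fun _ => supConst μ hμ * ‖p.snd‖) 2 volume :=
    memLp_indicator_const 2 measurableSet_Ioo _ (Or.inr (by simp))
  have h1 : ‖hm.toLp‖ = supConst μ hμ * ‖p.snd‖ := by
    rw [Lp.norm_toLp, eLpNorm_indicator_const measurableSet_Ioo (by norm_num) (by norm_num)]
    simp [abs_of_nonneg (supConst_nonneg hμ)]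
  rw [← h1]
  refine Lp.norm_le_norm_of_ae_le ?_
  filter_upwards [HZero.ae_abs_le hμ hp, HZero.ae_eq_zero hp, hm.coeFn_toLp] with x h2 h3 h4
  rw [h4]
  by_cases hx : x ∈ Ioo (0 : ℝ) 1
  · rw [indicator_of_mem hx, Real.norm_of_nonneg hC]
    exact h2
  · rw [h3 hx, norm_zero]
    exact norm_nonneg _

end HZero

/-! ### Fractional integrals of bounded functions -/

theorem sub_mul_measurePreserving {e : ℝ} (he : e = 1 ∨ e = -1) (x : ℝ) :
    MeasurePreserving (fun t : ℝ => x - e * t) volume volume := by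
  rcases he with rfl | rfl
  · simpa using Measure.measurePreserving_sub_left volume x
  · simpa using measurePreserving_add_left volume x

/-- Reflections and translations preserve null sets, so every pointwise value depends only on the
a.e. class. This permits passing to bounded representatives. -/
theorem fracInt_congr_ae {β e : ℝ} (he : e = 1 ∨ e = -1) {φ ψ : ℝ → ℝ} (h : φ =ᵐ[volume] ψ)
    (x : ℝ) : fracInt β e φ x = fracInt β e ψ x := by
  have h1 := (sub_mul_measurePreserving he x).quasiMeasurePreserving.ae h
  rw [fracInt, fracInt]
  congr 1
  refine integral_congr_ae (ae_restrict_of_ae ?_)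
  filter_upwards [h1] with t ht
  rw [ht]

theorem IsBddSupp.comp_sub_mul {φ : ℝ → ℝ} (hφ : IsBddSupp φ) {e : ℝ} (he : e = 1 ∨ e = -1)
    (x : ℝ) : IsBddSupp fun t => φ (x - e * t) := by
  obtain ⟨C, hC⟩ := hφ.bound
  obtain ⟨R, hR⟩ := hφ.supp
  have hea : |e| = 1 := by rcases he with rfl | rfl <;> norm_num
  refine ⟨hφ.measurable.comp (by fun_prop), ⟨C, fun t => hC _⟩, R + |x|, fun t ht => hR _ ?_⟩
  have := abs_sub x (x - e * t)
  rw [sub_sub_cancel, abs_mul, hea, one_mul] at this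
  linarith

theorem integrableOn_fracInt {β : ℝ} (hβ : 0 < β) {φ : ℝ → ℝ} (hφ : IsBddSupp φ) {e : ℝ}
    (he : e = 1 ∨ e = -1) (x : ℝ) :
    IntegrableOn (fun t : ℝ => t ^ (β - 1) * φ (x - e * t)) (Ioi 0) :=
  integrableOn_rpow_mul_of_isBddSupp hβ (hφ.comp_sub_mul he x)

theorem fracInt_add {β : ℝ} (hβ : 0 < β) {φ ψ : ℝ → ℝ} (hφ : IsBddSupp φ) (hψ : IsBddSupp ψ)
    {e : ℝ} (he : e = 1 ∨ e = -1) (x : ℝ) :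
    fracInt β e (φ + ψ) x = fracInt β e φ x + fracInt β e ψ x := by
  simp only [fracInt, Pi.add_apply, mul_add]
  rw [integral_add (integrableOn_fracInt hβ hφ he x) (integrableOn_fracInt hβ hψ he x), mul_add]

theorem fracInt_smul (β e c : ℝ) (φ : ℝ → ℝ) (x : ℝ) :
    fracInt β e (c • φ) x = c * fracInt β e φ x := by
  simp only [fracInt, Pi.smul_apply, smul_eq_mul, mul_left_comm _ c, integral_const_mul]

theorem measurable_fracInt {β e : ℝ} {φ : ℝ → ℝ} (hφ : Measurable φ) :
    Measurable (fracInt β e φ) := by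
  have h1 : Measurable fun t : ℝ => t ^ (β - 1) := measurable_id.pow_const _
  have h : StronglyMeasurable (Function.uncurry fun x t : ℝ => t ^ (β - 1) * φ (x - e * t)) :=
    ((h1.comp measurable_snd).mul (hφ.comp (by fun_prop))).stronglyMeasurable
  exact (h.integral_prod_right (ν := volume.restrict (Ioi 0))).measurable.const_mul _

/-- A bound for the fractional integrals on `[-r, r]` of functions bounded by one and supported in
`[-R, R]`. -/
def fracIntConst (β R r : ℝ) : ℝ := 1 / Real.Gamma β * ∫ t in Ioc 0 (R + r), t ^ (β - 1)

theorem fracIntConst_nonneg {β : ℝ} (hβ : 0 < β) (R r : ℝ) : 0 ≤ fracIntConst β R r :=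
  mul_nonneg (one_div_pos.2 (Real.Gamma_pos_of_pos hβ)).le
    (setIntegral_nonneg measurableSet_Ioc fun _ ht => Real.rpow_nonneg ht.1.le _)

theorem abs_fracInt_le {β : ℝ} (hβ : 0 < β) {e : ℝ} (he : e = 1 ∨ e = -1) {φ : ℝ → ℝ} {C R r : ℝ}
    (hC : ∀ x, |φ x| ≤ C) (hR : ∀ x, R < |x| → φ x = 0) {x : ℝ} (hx : |x| ≤ r) :
    |fracInt β e φ x| ≤ C * fracIntConst β R r := by
  have hG := one_div_pos.2 (Real.Gamma_pos_of_pos hβ)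
  have hea : |e| = 1 := by rcases he with rfl | rfl <;> norm_num
  have h1 : ∫ t in Ioi (0 : ℝ), t ^ (β - 1) * φ (x - e * t)
      = ∫ t in Ioc 0 (R + r), t ^ (β - 1) * φ (x - e * t) := by
    refine (setIntegral_eq_of_subset_of_forall_sdiff_eq_zero measurableSet_Ioi
      (fun t ht => ht.1) fun t ht => ?_)
    have ht0 : 0 < t := ht.1
    rw [hR, mul_zero]
    by_contra! h
    refine ht.2 ⟨ht0, ?_⟩
    have := abs_sub x (x - e * t)
    rw [sub_sub_cancel, abs_mul, hea, one_mul, abs_of_pos ht0] at this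
    linarith
  rw [fracInt, fracIntConst, h1, abs_mul, abs_of_pos hG, mul_left_comm]
  refine mul_le_mul_of_nonneg_left ?_ hG.le
  rw [← integral_const_mul]
  rw [← Real.norm_eq_abs]
  refine norm_integral_le_of_norm_le ((integrableOn_rpow_Ioc hβ _).const_mul C) ?_
  filter_upwards [ae_restrict_mem measurableSet_Ioc] with t ht
  rw [norm_mul, Real.norm_of_nonneg (Real.rpow_nonneg ht.1.le _), mul_comm]
  exact mul_le_mul_of_nonneg_right (hC _) (Real.rpow_nonneg ht.1.le _)

theorem memLp_fracInt_restrict {β : ℝ} (hβ : 0 < β) {e : ℝ} (he : e = 1 ∨ e = -1) {φ : ℝ → ℝ}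
    (hφ : IsBddSupp φ) : MemLp (fracInt β e φ) 2 (volume.restrict (Ioo (0 : ℝ) 1)) := by
  obtain ⟨C, hC⟩ := hφ.bound
  obtain ⟨R, hR⟩ := hφ.supp
  refine MemLp.of_bound (measurable_fracInt hφ.measurable).aestronglyMeasurable
    (C * fracIntConst β R 1) ?_
  filter_upwards [ae_restrict_mem measurableSet_Ioo] with x hx
  exact abs_fracInt_le hβ he hC hR (by rw [abs_of_pos hx.1]; exact hx.2.le)

/-! ### Weak derivatives on the completion: realness and support -/

/-- Both sides are continuous in `p`, being inner products with fixed `L²` functions, so the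
identity passes from test functions to the closure. The right side is an integral over `(0, 1)`
because the fractional integral of `deriv v` is only shown to be square integrable there. -/
theorem HZero.integral_fracDeriv_snd_mul {β : ℝ} (hβ : 0 < β) (hβ1 : β < 1) {e : ℝ}
    (he : e = 1 ∨ e = -1) {p : PairSpaceLine} (hp : p ∈ HZero (1 - β) 0 1) {v : ℝ → ℝ}
    (hv : ContDiff ℝ ∞ v) (hvs : HasCompactSupport v) :
    ∫ x, fracDeriv β he p.snd x * v x
      = -((∫ s in Ioo (0 : ℝ) 1, p.fst s * fracInt β (-e) (deriv v) s : ℝ) : ℂ) := by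
  have he' : -e = 1 ∨ -e = -1 := by rcases he with rfl | rfl <;> norm_num
  have hU := memLp_fracInt_restrict hβ he'
    (.of_continuous (contDiff_deriv hv).continuous hvs.deriv)
  have hl : ∀ p : PairSpaceLine, ∫ x, fracDeriv β he p.snd x * v x
      = inner ℂ ((toSchwartz hv hvs).toLp 2) (fracDeriv β he p.snd) := fun p => by
    rw [L2.inner_def]
    refine integral_congr_ae ?_
    filter_upwards [(toSchwartz hv hvs).coeFn_toLp 2] with x hx
    rw [hx, toSchwartz_apply, RCLike.inner_apply, Complex.conj_ofReal]
  have hr : ∀ p : PairSpaceLine,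
      ∫ s in Ioo (0 : ℝ) 1, p.fst s * fracInt β (-e) (deriv v) s
      = inner ℝ hU.toLp (LpToLpRestrictCLM ℝ ℝ ℝ volume 2 (Ioo 0 1) p.fst) := fun p => by
    rw [L2.inner_def]
    refine integral_congr_ae ?_
    filter_upwards [hU.coeFn_toLp, LpToLpRestrictCLM_coeFn ℝ (Ioo 0 1) p.fst] with x h1 h2
    rw [h1, h2]
    rfl
  have hfst := (WithLp.fstL 2 ℝ (Lp ℝ 2 (volume : Measure ℝ))
    (Lp ℂ 2 (volume : Measure ℝ))).continuous
  have hsnd := (WithLp.sndL 2 ℝ (Lp ℝ 2 (volume : Measure ℝ))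
    (Lp ℂ 2 (volume : Measure ℝ))).continuous
  have hclosed : IsClosed {p : PairSpaceLine | ∫ x, fracDeriv β he p.snd x * v x
      = -((∫ s in Ioo (0 : ℝ) 1, p.fst s * fracInt β (-e) (deriv v) s : ℝ) : ℂ)} := by
    simp only [hl, hr]
    refine isClosed_eq ?_ ?_
    · exact Continuous.inner continuous_const ((fracDeriv β he).continuous.comp hsnd)
    · exact (Complex.continuous_ofReal.comp (Continuous.inner continuous_const
        ((LpToLpRestrictCLM ℝ ℝ ℝ volume 2 (Ioo 0 1)).continuous.comp hfst))).neg
  refine closure_minimal ?_ hclosed hp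
  rintro q ⟨w, hw, h1, h2⟩
  have h3 := integral_fracDeriv_mul hβ hβ1 he hw.smooth hw.hasCompactSupport hv hvs h2
  rw [mem_ofPred_eq, h3]
  congr 2
  rw [← setIntegral_eq_integral_of_forall_compl_eq_zero (s := Ioo (0 : ℝ) 1)]
  · refine integral_congr_ae (ae_restrict_of_ae ?_)
    filter_upwards [h1] with x hx
    rw [hx]
  · intro x hx
    rw [mul_eq_zero]
    left
    by_contra h
    exact hx (hw.tsupport_subset (subset_tsupport w h))

section Support

variable {β : ℝ} {p : PairSpaceLine}

/-- All pairings with real test functions are real. -/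
theorem HZero.fracDeriv_im_eq_zero (hβ : 0 < β) (hβ1 : β < 1) {e : ℝ}
    (he : e = 1 ∨ e = -1) (hp : p ∈ HZero (1 - β) 0 1) :
    ∀ᵐ x, (fracDeriv β he p.snd x).im = 0 := by
  have hm := Lp.memLp (fracDeriv β he p.snd)
  refine ae_eq_zero_of_integral_contDiff_smul_eq_zero
    (hm.im.locallyIntegrable (by norm_num)) fun v hv hvs => ?_
  have h := HZero.integral_fracDeriv_snd_mul hβ hβ1 he hp hv hvs
  have hint : Integrable fun x => fracDeriv β he p.snd x * (v x : ℂ) :=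
    hm.integrable_mul (q := 2) ((hv.continuous.memLp_of_hasCompactSupport hvs).ofReal)
  have h2 := congrArg Complex.im h
  rw [← Complex.ofReal_neg, Complex.ofReal_im] at h2
  change RCLike.im (∫ x, _ : ℂ) = 0 at h2
  rw [← integral_im hint] at h2
  rw [← h2]
  congr 1 with x
  change _ = (_ * _ : ℂ).im
  rw [Complex.im_mul_ofReal, smul_eq_mul, mul_comm]

/-- For `v` supported in `U`, the adjoint integral of `deriv v` at `s` sees only the points `s + e *
t` with `t > 0`, which avoid `U` when `s` is in `(0, 1)`. -/
theorem HZero.fracDeriv_eq_zero (hβ : 0 < β) (hβ1 : β < 1) {e : ℝ}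
    (he : e = 1 ∨ e = -1) (hp : p ∈ HZero (1 - β) 0 1) {U : Set ℝ} (hU : IsOpen U)
    (hdisj : ∀ s ∈ Ioo (0 : ℝ) 1, ∀ t > 0, s + e * t ∉ U) :
    ∀ᵐ x, x ∈ U → fracDeriv β he p.snd x = 0 := by
  have hm := Lp.memLp (fracDeriv β he p.snd)
  refine hU.ae_eq_zero_of_integral_contDiff_smul_eq_zero
    ((hm.locallyIntegrable (by norm_num)).locallyIntegrableOn U) fun v hv hvs hvU => ?_
  have h := HZero.integral_fracDeriv_snd_mul hβ hβ1 he hp hv hvs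
  have h0 : ∀ s ∈ Ioo (0 : ℝ) 1, fracInt β (-e) (deriv v) s = 0 := fun s hs => by
    rw [fracInt, setIntegral_eq_zero_of_forall_eq_zero, mul_zero]
    intro t ht
    rw [mul_eq_zero]
    right
    by_contra h
    have := hvU (tsupport_deriv_subset (f := v) (subset_tsupport _ h))
    rw [neg_mul, sub_neg_eq_add] at this
    exact hdisj s hs t ht this
  rw [setIntegral_eq_zero_of_forall_eq_zero fun s hs => by rw [h0 s hs, mul_zero]] at h
  simp only [Complex.ofReal_zero, neg_zero] at h
  rw [← h]
  congr 1 with x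
  rw [Complex.real_smul, mul_comm]

end Support

/-! ### The integrals on the interval -/

theorem leftFracInt_eq {β : ℝ} {φ ψ : ℝ → ℝ} (h : φ =ᵐ[volume] ψ)
    (hψ : ∀ x ∉ Ioo (0 : ℝ) 1, ψ x = 0) {x : ℝ} (hx : x ∈ Ioo (0 : ℝ) 1) :
    leftFracInt 0 β φ x = fracInt β 1 ψ x := by
  have h1 : ∫ s in (0 : ℝ)..x, φ s / (x - s) ^ (1 - β)
      = ∫ s in (0 : ℝ)..x, ψ s / (x - s) ^ (1 - β) := by
    refine intervalIntegral.integral_congr_ae ?_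
    filter_upwards [h] with s hs _
    rw [hs]
  have h2 := intervalIntegral.integral_comp_sub_left (a := 0) (b := x)
    (fun t => ψ (x - t) / t ^ (1 - β)) x
  simp only [sub_sub_cancel, sub_self, sub_zero] at h2
  rw [leftFracInt, fracInt, h1, h2, intervalIntegral.integral_of_le hx.1.le]
  congr 1
  rw [setIntegral_eq_of_subset_of_forall_sdiff_eq_zero (t := Ioi (0 : ℝ)) (s := Ioc 0 x)
    measurableSet_Ioi (fun t ht => ht.1)]
  · refine setIntegral_congr_fun measurableSet_Ioc fun t ht => ?_
    rw [← neg_sub β 1, Real.rpow_neg ht.1.le, one_mul, div_inv_eq_mul, mul_comm]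
  · intro t ht
    rw [hψ, mul_zero]
    intro h3
    exact ht.2 ⟨ht.1, by linarith [h3.1]⟩

theorem rightFracInt_eq {β : ℝ} {φ ψ : ℝ → ℝ} (h : φ =ᵐ[volume] ψ)
    (hψ : ∀ x ∉ Ioo (0 : ℝ) 1, ψ x = 0) {x : ℝ} (hx : x ∈ Ioo (0 : ℝ) 1) :
    rightFracInt 1 β φ x = fracInt β (-1) ψ x := by
  have h1 : ∫ s in x..1, φ s / (s - x) ^ (1 - β) = ∫ s in x..1, ψ s / (s - x) ^ (1 - β) := by
    refine intervalIntegral.integral_congr_ae ?_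
    filter_upwards [h] with s hs _
    rw [hs]
  have h2 := intervalIntegral.integral_comp_sub_right (a := x) (b := 1)
    (fun t => ψ (x + t) / t ^ (1 - β)) x
  simp only [add_sub_cancel, sub_self] at h2
  rw [rightFracInt, fracInt, h1, h2, intervalIntegral.integral_of_le (by linarith [hx.2])]
  congr 1
  rw [setIntegral_eq_of_subset_of_forall_sdiff_eq_zero (t := Ioi (0 : ℝ)) (s := Ioc 0 (1 - x))
    measurableSet_Ioi (fun t ht => ht.1)]
  · refine setIntegral_congr_fun measurableSet_Ioc fun t ht => ?_
    rw [← neg_sub β 1, Real.rpow_neg ht.1.le, neg_one_mul, sub_neg_eq_add, div_inv_eq_mul,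
      mul_comm]
  · intro t ht
    rw [hψ, mul_zero]
    intro h3
    exact ht.2 ⟨ht.1, by linarith [h3.2]⟩

theorem intervalIntegrable_mul_of_ae_bound {φ k : ℝ → ℝ} {C a b : ℝ}
    (hφ : AEStronglyMeasurable φ volume) (hC : ∀ᵐ x, |φ x| ≤ C)
    (hk : IntervalIntegrable k volume a b) :
    IntervalIntegrable (fun s => φ s * k s) volume a b :=
  ⟨hk.1.bdd_mul (c := C) hφ.restrict (ae_restrict_of_ae hC),
    hk.2.bdd_mul (c := C) hφ.restrict (ae_restrict_of_ae hC)⟩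

/-- Since `1 - β > 1/2`, `φ` is essentially bounded and the kernel singularity is integrable. -/
theorem HZero.intervalIntegrable_left {β : ℝ} (hβ : 0 < β) (hβ1 : β < 1 / 2)
    (φ : HZero (1 - β) 0 1) {x : ℝ} (hx : x ∈ Icc (0 : ℝ) 1) :
    IntervalIntegrable (fun s => HZero.fn φ s / (x - s) ^ (1 - β)) volume 0 x := by
  have h1 : IntervalIntegrable (fun t : ℝ => t ^ (β - 1)) volume 0 x :=
    intervalIntegral.intervalIntegrable_rpow' (by linarith)
  have h2 := (h1.comp_sub_left x).symm
  rw [sub_self, sub_zero] at h2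
  refine (intervalIntegrable_mul_of_ae_bound (Lp.aestronglyMeasurable φ.1.fst)
    (HZero.ae_abs_le (by linarith) φ.2) h2).congr ?_
  intro s hs
  rw [uIoc_of_le hx.1] at hs
  change φ.1.fst s * (x - s) ^ (β - 1) = φ.1.fst s / (x - s) ^ (1 - β)
  rw [← neg_sub 1 β, Real.rpow_neg (by linarith [hs.2]), div_eq_mul_inv]

theorem HZero.intervalIntegrable_right {β : ℝ} (hβ : 0 < β) (hβ1 : β < 1 / 2)
    (φ : HZero (1 - β) 0 1) {x : ℝ} (hx : x ∈ Icc (0 : ℝ) 1) :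
    IntervalIntegrable (fun s => HZero.fn φ s / (s - x) ^ (1 - β)) volume x 1 := by
  have h1 : IntervalIntegrable (fun t : ℝ => t ^ (β - 1)) volume 0 (1 - x) :=
    intervalIntegral.intervalIntegrable_rpow' (by linarith)
  have h2 := h1.comp_sub_right x
  rw [zero_add, sub_add_cancel] at h2
  refine (intervalIntegrable_mul_of_ae_bound (Lp.aestronglyMeasurable φ.1.fst)
    (HZero.ae_abs_le (by linarith) φ.2) h2).congr ?_
  intro s hs
  rw [uIoc_of_le hx.2] at hs
  change φ.1.fst s * (s - x) ^ (β - 1) = φ.1.fst s / (s - x) ^ (1 - β)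
  rw [← neg_sub 1 β, Real.rpow_neg (by linarith [hs.1]), div_eq_mul_inv]

/-! ### The operator into `L²(0, 1)` -/

/-- The two-sided fractional integral on the line. -/
def lineFracInt (β θ : ℝ) (φ : ℝ → ℝ) (x : ℝ) : ℝ :=
  θ * fracInt β 1 φ x + (1 - θ) * fracInt β (-1) φ x

theorem isBddSupp_of_Ioo {ψ : ℝ → ℝ} {C : ℝ} (hm : Measurable ψ) (hC : ∀ x, |ψ x| ≤ C)
    (h0 : ∀ x ∉ Ioo (0 : ℝ) 1, ψ x = 0) : IsBddSupp ψ :=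
  ⟨hm, ⟨C, hC⟩, 1, fun x hx => h0 x fun h => by
    rw [abs_of_pos h.1] at hx
    linarith [h.2]⟩

theorem lineFracInt_congr_ae {β θ : ℝ} {φ ψ : ℝ → ℝ} (h : φ =ᵐ[volume] ψ) :
    lineFracInt β θ φ = lineFracInt β θ ψ :=
  funext fun x => by
    rw [lineFracInt, lineFracInt, fracInt_congr_ae (Or.inl rfl) h, fracInt_congr_ae (Or.inr rfl) h]

theorem lineFracInt_add {β : ℝ} (hβ : 0 < β) (θ : ℝ) {φ ψ : ℝ → ℝ} (hφ : IsBddSupp φ)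
    (hψ : IsBddSupp ψ) : lineFracInt β θ (φ + ψ) = lineFracInt β θ φ + lineFracInt β θ ψ :=
  funext fun x => by
    rw [Pi.add_apply, lineFracInt, lineFracInt, lineFracInt, fracInt_add hβ hφ hψ (Or.inl rfl),
      fracInt_add hβ hφ hψ (Or.inr rfl)]
    ring

theorem lineFracInt_smul (β θ c : ℝ) (φ : ℝ → ℝ) :
    lineFracInt β θ (c • φ) = c • lineFracInt β θ φ :=
  funext fun x => by
    rw [Pi.smul_apply, lineFracInt, lineFracInt, fracInt_smul, fracInt_smul, smul_eq_mul]
    ring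

theorem twoSidedFracInt_eq {β θ : ℝ} {φ ψ : ℝ → ℝ} (h : φ =ᵐ[volume] ψ)
    (hψ : ∀ x ∉ Ioo (0 : ℝ) 1, ψ x = 0) {x : ℝ} (hx : x ∈ Ioo (0 : ℝ) 1) :
    twoSidedFracInt 0 1 θ β φ x = lineFracInt β θ φ x := by
  rw [lineFracInt_congr_ae h, twoSidedFracInt, lineFracInt, leftFracInt_eq h hψ hx,
    rightFracInt_eq h hψ hx]

theorem memLp_lineFracInt {β : ℝ} (hβ : 0 < β) (θ : ℝ) {φ : ℝ → ℝ} (hφ : IsBddSupp φ) :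
    MemLp (lineFracInt β θ φ) 2 (volume.restrict (Ioo (0 : ℝ) 1)) :=
  ((memLp_fracInt_restrict hβ (Or.inl rfl) hφ).const_mul θ).add
    ((memLp_fracInt_restrict hβ (Or.inr rfl) hφ).const_mul (1 - θ))

theorem HZero.exists_isBddSupp' {μ : ℝ} (hμ : 1 / 2 < μ) (φ : HZero μ 0 1) :
    ∃ ψ, IsBddSupp ψ ∧ φ.1.fst =ᵐ[volume] ψ := by
  obtain ⟨ψ, h1, h2, h3, h4⟩ := HZero.exists_isBddSupp hμ φ.2
  exact ⟨ψ, isBddSupp_of_Ioo h1 h2 h3, h4⟩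

theorem HZero.memLp_lineFracInt {β : ℝ} (hβ : 0 < β) (hβ1 : β < 1 / 2) (θ : ℝ)
    (φ : HZero (1 - β) 0 1) :
    MemLp (lineFracInt β θ φ.1.fst) 2 (volume.restrict (Ioo (0 : ℝ) 1)) := by
  obtain ⟨ψ, h1, h2⟩ := HZero.exists_isBddSupp' (by linarith) φ
  rw [lineFracInt_congr_ae h2]
  exact _root_.memLp_lineFracInt hβ θ h1

/-- The two-sided fractional integral as a linear map from `H^{1-β}_0(0, 1)` to `L²(0, 1)`. -/
def fracIntLp {β : ℝ} (hβ : 0 < β) (hβ1 : β < 1 / 2) (θ : ℝ) :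
    HZero (1 - β) 0 1 →ₗ[ℝ] Lp ℝ 2 (volume.restrict (Ioo (0 : ℝ) 1)) where
  toFun φ := (HZero.memLp_lineFracInt hβ hβ1 θ φ).toLp
  map_add' φ χ := by
    obtain ⟨ψ, h1, h2⟩ := HZero.exists_isBddSupp' (by linarith) φ
    obtain ⟨χ', h3, h4⟩ := HZero.exists_isBddSupp' (by linarith) χ
    rw [← MemLp.toLp_add]
    refine MemLp.toLp_congr _ _ (Filter.Eventually.of_forall fun x => ?_)
    have h5 : (φ + χ).1.fst =ᵐ[volume] ψ + χ' := (Lp.coeFn_add φ.1.fst χ.1.fst).trans (h2.add h4)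
    rw [lineFracInt_congr_ae h5, lineFracInt_congr_ae h2, lineFracInt_congr_ae h4,
      lineFracInt_add hβ θ h1 h3]
  map_smul' c φ := by
    rw [RingHom.id_apply, ← MemLp.toLp_const_smul]
    refine MemLp.toLp_congr _ _ (Filter.Eventually.of_forall fun x => ?_)
    have h5 : (c • φ).1.fst =ᵐ[volume] c • (φ.1.fst : ℝ → ℝ) := Lp.coeFn_smul c φ.1.fst
    rw [lineFracInt_congr_ae h5, lineFracInt_smul]

theorem coeFn_fracIntLp {β : ℝ} (hβ : 0 < β) (hβ1 : β < 1 / 2) (θ : ℝ) (φ : HZero (1 - β) 0 1) :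
    fracIntLp hβ hβ1 θ φ =ᵐ[volume.restrict (Ioo (0 : ℝ) 1)] lineFracInt β θ φ.1.fst :=
  (HZero.memLp_lineFracInt hβ hβ1 θ φ).coeFn_toLp

theorem norm_fracIntLp_le {β : ℝ} (hβ : 0 < β) (hβ1 : β < 1 / 2) {θ : ℝ} (hθ0 : 0 ≤ θ)
    (hθ1 : θ ≤ 1) (φ : HZero (1 - β) 0 1) :
    ‖fracIntLp hβ hβ1 θ φ‖
      ≤ supConst (1 - β) (by linarith) * fracIntConst β 1 1 * ‖φ‖ := by
  obtain ⟨ψ, h1, h2, h3, h4⟩ := HZero.exists_isBddSupp (by linarith) φ.2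
  have hc := supConst_nonneg (μ := 1 - β) (by linarith)
  have hf := fracIntConst_nonneg hβ 1 1
  have hR : ∀ x, 1 < |x| → ψ x = 0 := fun x hx => h3 x fun h => by
    rw [abs_of_pos h.1] at hx
    linarith [h.2]
  have hb : ∀ᵐ x ∂(volume.restrict (Ioo (0 : ℝ) 1)), ‖fracIntLp hβ hβ1 θ φ x‖
      ≤ supConst (1 - β) (by linarith) * ‖φ.1.snd‖ * fracIntConst β 1 1 := by
    filter_upwards [coeFn_fracIntLp hβ hβ1 θ φ, ae_restrict_mem measurableSet_Ioo] with x hx hx'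
    have hx1 : |x| ≤ 1 := by rw [abs_of_pos hx'.1]; exact hx'.2.le
    rw [hx, lineFracInt_congr_ae h4, lineFracInt, Real.norm_eq_abs]
    have a1 := abs_fracInt_le hβ (Or.inl rfl : (1 : ℝ) = 1 ∨ (1 : ℝ) = -1) h2 hR hx1
    have a2 := abs_fracInt_le hβ (Or.inr rfl : (-1 : ℝ) = 1 ∨ (-1 : ℝ) = -1) h2 hR hx1
    refine (abs_add_le _ _).trans ?_
    rw [abs_mul, abs_mul, abs_of_nonneg hθ0, abs_of_nonneg (sub_nonneg.2 hθ1)]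
    nlinarith [mul_le_mul_of_nonneg_left a1 hθ0, mul_le_mul_of_nonneg_left a2 (sub_nonneg.2 hθ1)]
  have := Lp.norm_le_of_ae_bound (by positivity) hb
  refine this.trans ?_
  have hs : ‖φ.1.snd‖ ≤ ‖φ‖ := WithLp.norm_snd_le _ φ.1
  rw [show measureUnivNNReal (volume.restrict (Ioo (0 : ℝ) 1)) = 1 by
    simp [measureUnivNNReal]]
  simp only [NNReal.coe_one, Real.one_rpow, one_mul]
  rw [mul_right_comm]
  gcongr

/-! ### The derivative on the interval and its coercivity -/

/-- The real part on `(0, 1)` of a complex function on the line. -/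
def reRestrict : Lp ℂ 2 (volume : Measure ℝ) →L[ℝ] Lp ℝ 2 (volume.restrict (Ioo (0 : ℝ) 1)) :=
  LpToLpRestrictCLM ℝ ℝ ℝ volume 2 (Ioo 0 1) ∘L Complex.reCLM.compLpL 2 volume

theorem coeFn_reRestrict (F : Lp ℂ 2 (volume : Measure ℝ)) :
    reRestrict F =ᵐ[volume.restrict (Ioo (0 : ℝ) 1)] fun x => (F x).re := by
  have h1 := LpToLpRestrictCLM_coeFn ℝ (Ioo (0 : ℝ) 1) (Complex.reCLM.compLpL 2 volume F)
  have h2 := ae_restrict_of_ae (s := Ioo (0 : ℝ) 1)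
    (Complex.reCLM.coeFn_compLpL (p := 2) (μ := volume) F)
  exact h1.trans h2

theorem norm_reRestrict_le (F : Lp ℂ 2 (volume : Measure ℝ)) : ‖reRestrict F‖ ≤ ‖F‖ := by
  refine (norm_Lp_toLp_restrict_le (Ioo (0 : ℝ) 1) (Complex.reCLM.compLpL 2 volume F)).trans ?_
  refine Lp.norm_le_norm_of_ae_le ?_
  filter_upwards [Complex.reCLM.coeFn_compLpL (p := 2) (μ := volume) F] with x hx
  rw [hx]
  exact Complex.abs_re_le_norm _

/-- The derivative on `(0, 1)` of the one-sided fractional integral. -/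
def fracDerivLp (β : ℝ) {e : ℝ} (he : e = 1 ∨ e = -1) :
    HZero (1 - β) 0 1 →L[ℝ] Lp ℝ 2 (volume.restrict (Ioo (0 : ℝ) 1)) :=
  reRestrict ∘L (fracDeriv β he).restrictScalars ℝ ∘L
    WithLp.sndL 2 ℝ (Lp ℝ 2 (volume : Measure ℝ)) (Lp ℂ 2 (volume : Measure ℝ)) ∘L
    (HZero (1 - β) 0 1).subtypeL

theorem coeFn_fracDerivLp (β : ℝ) {e : ℝ} (he : e = 1 ∨ e = -1) (φ : HZero (1 - β) 0 1) :
    fracDerivLp β he φ =ᵐ[volume.restrict (Ioo (0 : ℝ) 1)]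
      fun x => (fracDeriv β he φ.1.snd x).re :=
  coeFn_reRestrict _

theorem norm_fracDerivLp_le (β : ℝ) {e : ℝ} (he : e = 1 ∨ e = -1) (φ : HZero (1 - β) 0 1) :
    ‖fracDerivLp β he φ‖ ≤ (2 * Real.pi) ^ (1 - β) * ‖φ.1.snd‖ :=
  (norm_reRestrict_le _).trans (norm_fracDeriv β he _).le

/-- Adjointness returns the fractional integral from `deriv v` to the function, which exhibits
`fracDerivLp` as a weak derivative. -/
theorem integral_fracDerivLp_mul {β : ℝ} (hβ : 0 < β) (hβ1 : β < 1) {e : ℝ}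
    (he : e = 1 ∨ e = -1) (φ : HZero (1 - β) 0 1) {ψ : ℝ → ℝ} (hψ : IsBddSupp ψ)
    (h0 : ∀ x ∉ Ioo (0 : ℝ) 1, ψ x = 0) (h : φ.1.fst =ᵐ[volume] ψ) {v : ℝ → ℝ}
    (hv : IsTestFunction 0 1 v) :
    ∫ x in Ioo (0 : ℝ) 1, fracDerivLp β he φ x * v x = -∫ x, fracInt β e ψ x * deriv v x := by
  have h1 := HZero.integral_fracDeriv_snd_mul hβ hβ1 he φ.2 hv.smooth hv.hasCompactSupport
  have h2 : ∫ s in Ioo (0 : ℝ) 1, φ.1.fst s * fracInt β (-e) (deriv v) s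
      = ∫ x, fracInt β e ψ x * deriv v x := by
    rw [integral_fracInt_mul hβ he hψ (.of_continuous (contDiff_deriv hv.smooth).continuous
      hv.hasCompactSupport.deriv)]
    refine Eq.trans ?_ (setIntegral_eq_integral_of_forall_compl_eq_zero
      (s := Ioo (0 : ℝ) 1) (fun x hx => by rw [h0 x hx, zero_mul]))
    refine integral_congr_ae (ae_restrict_of_ae ?_)
    filter_upwards [h] with x hx
    rw [hx]
  have hint : Integrable fun x => fracDeriv β he φ.1.snd x * (v x : ℂ) :=
    (Lp.memLp _).integrable_mul (q := 2)
      ((hv.smooth.continuous.memLp_of_hasCompactSupport hv.hasCompactSupport).ofReal)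
  have h3 := congrArg Complex.re h1
  rw [← Complex.ofReal_neg, Complex.ofReal_re, h2] at h3
  change RCLike.re (∫ x, _ : ℂ) = _ at h3
  rw [← integral_re hint] at h3
  rw [← h3]
  refine Eq.trans ?_ (setIntegral_eq_integral_of_forall_compl_eq_zero (s := Ioo (0 : ℝ) 1) ?_)
  · refine integral_congr_ae ?_
    filter_upwards [coeFn_fracDerivLp β he φ] with x hx
    rw [hx]
    exact (Complex.re_mul_ofReal _ _).symm
  · intro x hx
    have : v x = 0 := by
      by_contra h
      exact hx (hv.tsupport_subset (subset_tsupport v h))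
    simp [this]

/-- The left derivative vanishes on `x < 0` and the right one on `x > 1`, so their product vanishes
a.e. outside `(0, 1)`. The inner product over the line is thus the one over the interval, with real
factors. -/
theorem inner_fracDerivLp {β : ℝ} (hβ : 0 < β) (hβ1 : β < 1) (φ : HZero (1 - β) 0 1) :
    inner ℝ (fracDerivLp β (Or.inl rfl : (1 : ℝ) = 1 ∨ (1 : ℝ) = -1) φ)
      (fracDerivLp β (Or.inr rfl : (-1 : ℝ) = 1 ∨ (-1 : ℝ) = -1) φ)
      = Real.cos (Real.pi * β) * ((2 * Real.pi) ^ (1 - β) * ‖φ.1.snd‖) ^ 2 := by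
  set F := fracDeriv β (Or.inl rfl : (1 : ℝ) = 1 ∨ (1 : ℝ) = -1) φ.1.snd with hF
  set K := fracDeriv β (Or.inr rfl : (-1 : ℝ) = 1 ∨ (-1 : ℝ) = -1) φ.1.snd with hK
  have hF0 : ∀ᵐ x, x ∈ Iio (0 : ℝ) → F x = 0 :=
    HZero.fracDeriv_eq_zero hβ hβ1 _ φ.2 isOpen_Iio fun s hs t ht h => by
      have h : s + 1 * t < 0 := h
      linarith [hs.1]
  have hK0 : ∀ᵐ x, x ∈ Ioi (1 : ℝ) → K x = 0 :=
    HZero.fracDeriv_eq_zero hβ hβ1 _ φ.2 isOpen_Ioi fun s hs t ht h => by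
      have h : 1 < s + -1 * t := h
      linarith [hs.2]
  have hFi := HZero.fracDeriv_im_eq_zero hβ hβ1 (Or.inl rfl : (1 : ℝ) = 1 ∨ (1 : ℝ) = -1) φ.2
  have hKi := HZero.fracDeriv_im_eq_zero hβ hβ1 (Or.inr rfl : (-1 : ℝ) = 1 ∨ (-1 : ℝ) = -1) φ.2
  have h01 : ∀ᵐ x : ℝ, x ≠ 0 := by simp [ae_iff]
  have h11 : ∀ᵐ x : ℝ, x ≠ 1 := by simp [ae_iff]
  rw [← re_inner_fracDeriv, L2.inner_def, L2.inner_def]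
  change _ = RCLike.re (∫ x, inner ℂ _ _ : ℂ)
  rw [← integral_re (L2.integrable_inner _ _), ← integral_indicator measurableSet_Ioo]
  refine integral_congr_ae ?_
  have h1 := (ae_restrict_iff' measurableSet_Ioo).1
    (coeFn_fracDerivLp β (Or.inl rfl : (1 : ℝ) = 1 ∨ (1 : ℝ) = -1) φ)
  have h2 := (ae_restrict_iff' measurableSet_Ioo).1
    (coeFn_fracDerivLp β (Or.inr rfl : (-1 : ℝ) = 1 ∨ (-1 : ℝ) = -1) φ)
  filter_upwards [hF0, hK0, hFi, hKi, h01, h11, h1, h2] with x a1 a2 a3 a4 a5 a6 a7 a8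
  by_cases hx : x ∈ Ioo (0 : ℝ) 1
  · rw [indicator_of_mem hx, a7 hx, a8 hx]
    change (K x).re * (F x).re = (K x * (starRingEnd ℂ) (F x)).re
    have a4' : (K x).im = 0 := a4
    rw [Complex.mul_re, Complex.conj_re, a4', zero_mul, sub_zero]
  · rw [indicator_of_notMem hx]
    change 0 = (K x * (starRingEnd ℂ) (F x)).re
    rcases lt_trichotomy x 0 with h | h | h
    · rw [a1 h, map_zero, mul_zero, Complex.zero_re]
    · exact absurd h a5
    · have h' : 1 < x := by
        rcases lt_trichotomy x 1 with h' | h' | h'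
        · exact absurd ⟨h, h'⟩ hx
        · exact absurd h' a6
        · exact h'
      rw [a2 h', zero_mul, Complex.zero_re]

/-- The derivative on `(0, 1)` of the two-sided fractional integral. -/
def twoSidedFracDerivLp (β θ : ℝ) :
    HZero (1 - β) 0 1 →L[ℝ] Lp ℝ 2 (volume.restrict (Ioo (0 : ℝ) 1)) :=
  θ • fracDerivLp β (Or.inl rfl : (1 : ℝ) = 1 ∨ (1 : ℝ) = -1) +
    (1 - θ) • fracDerivLp β (Or.inr rfl : (-1 : ℝ) = 1 ∨ (-1 : ℝ) = -1)

/-- Pairing with `a + b` leaves the mixed term `⟪a, b⟫` with coefficient `θ + (1 - θ) = 1`, and the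
square terms are nonnegative. Cauchy–Schwarz and `‖a + b‖ ≤ 2N` finish; this works at both endpoints
`θ = 0` and `θ = 1`. -/
theorem norm_snd_le_twoSidedFracDerivLp {β θ : ℝ} (hβ : 0 < β) (hβ1 : β < 1) (hθ0 : 0 ≤ θ)
    (hθ1 : θ ≤ 1) (φ : HZero (1 - β) 0 1) :
    Real.cos (Real.pi * β) * ((2 * Real.pi) ^ (1 - β) * ‖φ.1.snd‖)
      ≤ 2 * ‖twoSidedFracDerivLp β θ φ‖ := by
  have hN : 0 ≤ (2 * Real.pi) ^ (1 - β) * ‖φ.1.snd‖ := by positivity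
  have h1 := inner_fracDerivLp hβ hβ1 φ
  have ha := norm_fracDerivLp_le β (Or.inl rfl : (1 : ℝ) = 1 ∨ (1 : ℝ) = -1) φ
  have hb := norm_fracDerivLp_le β (Or.inr rfl : (-1 : ℝ) = 1 ∨ (-1 : ℝ) = -1) φ
  have hf : twoSidedFracDerivLp β θ φ
      = θ • fracDerivLp β (Or.inl rfl : (1 : ℝ) = 1 ∨ (1 : ℝ) = -1) φ
        + (1 - θ) • fracDerivLp β (Or.inr rfl : (-1 : ℝ) = 1 ∨ (-1 : ℝ) = -1) φ := rfl
  generalize fracDerivLp β (Or.inl rfl : (1 : ℝ) = 1 ∨ (1 : ℝ) = -1) φ = a at *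
  generalize fracDerivLp β (Or.inr rfl : (-1 : ℝ) = 1 ∨ (-1 : ℝ) = -1) φ = b at *
  generalize (2 * Real.pi) ^ (1 - β) * ‖φ.1.snd‖ = N at *
  rw [hf]
  have h2 : inner ℝ (θ • a + (1 - θ) • b) (a + b)
      = θ * ‖a‖ ^ 2 + (1 - θ) * ‖b‖ ^ 2 + inner ℝ a b := by
    simp only [inner_add_left, inner_add_right, real_inner_smul_left, real_inner_self_eq_norm_sq,
      real_inner_comm a b]
    ring
  have h3 := real_inner_le_norm (θ • a + (1 - θ) • b) (a + b)
  have h4 : ‖a + b‖ ≤ 2 * N := (norm_add_le a b).trans (by linarith)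
  have h5 : Real.cos (Real.pi * β) * N ^ 2 ≤ ‖θ • a + (1 - θ) • b‖ * (2 * N) := by
    rw [← h1]
    have := mul_le_mul_of_nonneg_left h4 (norm_nonneg (θ • a + (1 - θ) • b))
    nlinarith [mul_nonneg hθ0 (sq_nonneg ‖a‖), mul_nonneg (sub_nonneg.2 hθ1) (sq_nonneg ‖b‖)]
  rcases hN.eq_or_lt with h | h
  · rw [← h, mul_zero]
    positivity
  · refine le_of_mul_le_mul_right ?_ h
    linarith

/-! ### The operator into `H¹(0, 1)` and its lower bound -/

/-- The two-sided fractional integral operator from `H^{1-β}_0(0, 1)` to pairs of a function and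
its weak derivative. -/
def fracIntPair {β : ℝ} (hβ : 0 < β) (hβ1 : β < 1 / 2) {θ : ℝ} (hθ0 : 0 ≤ θ) (hθ1 : θ ≤ 1) :
    HZero (1 - β) 0 1 →L[ℝ] PairSpace 0 1 :=
  ((WithLp.prodContinuousLinearEquiv 2 ℝ (Lp ℝ 2 (volume.restrict (Ioo (0 : ℝ) 1)))
    (Lp ℝ 2 (volume.restrict (Ioo (0 : ℝ) 1)))).symm : _ →L[ℝ] PairSpace 0 1) ∘L
    (((fracIntLp hβ hβ1 θ).mkContinuous _ (norm_fracIntLp_le hβ hβ1 hθ0 hθ1)).prod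
      (twoSidedFracDerivLp β θ))

section Operator

variable {β θ : ℝ} (hβ : 0 < β) (hβ1 : β < 1 / 2) (hθ0 : 0 ≤ θ) (hθ1 : θ ≤ 1)

theorem fst_fracIntPair (φ : HZero (1 - β) 0 1) :
    (fracIntPair hβ hβ1 hθ0 hθ1 φ).fst = fracIntLp hβ hβ1 θ φ := rfl

theorem snd_fracIntPair (φ : HZero (1 - β) 0 1) :
    (fracIntPair hβ hβ1 hθ0 hθ1 φ).snd = twoSidedFracDerivLp β θ φ := rfl

theorem fracIntPair_mem_HOne (φ : HZero (1 - β) 0 1) :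
    fracIntPair hβ hβ1 hθ0 hθ1 φ ∈ HOne 0 1 := by
  intro v hv
  obtain ⟨ψ, h1, h2, h3, h4⟩ := HZero.exists_isBddSupp (by linarith) φ.2
  have hψ := isBddSupp_of_Ioo h1 h2 h3
  have hβ1' : β < 1 := by linarith
  have ha := integral_fracDerivLp_mul hβ hβ1' (Or.inl rfl : (1 : ℝ) = 1 ∨ (1 : ℝ) = -1)
    φ hψ h3 h4 hv
  have hb := integral_fracDerivLp_mul hβ hβ1' (Or.inr rfl : (-1 : ℝ) = 1 ∨ (-1 : ℝ) = -1)
    φ hψ h3 h4 hv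
  have hv0 : ∀ x ∉ Ioo (0 : ℝ) 1, deriv v x = 0 := fun x hx => by
    by_contra h
    exact hx (hv.tsupport_subset (tsupport_deriv_subset (f := v) (subset_tsupport _ h)))
  have hd := ((contDiff_deriv hv.smooth).continuous.memLp_of_hasCompactSupport (p := 2)
    hv.hasCompactSupport.deriv (μ := volume)).restrict (Ioo (0 : ℝ) 1)
  have hint : ∀ e : ℝ, (e = 1 ∨ e = -1) → Integrable (fun x => fracInt β e ψ x * deriv v x)
      (volume.restrict (Ioo (0 : ℝ) 1)) := fun e he =>
    (memLp_fracInt_restrict hβ he hψ).integrable_mul hd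
  have hset : ∀ e : ℝ, ∫ x, fracInt β e ψ x * deriv v x
      = ∫ x in Ioo (0 : ℝ) 1, fracInt β e ψ x * deriv v x := fun e =>
    (setIntegral_eq_integral_of_forall_compl_eq_zero fun x hx => by rw [hv0 x hx, mul_zero]).symm
  rw [hset] at ha hb
  rw [fst_fracIntPair, snd_fracIntPair]
  have e1 : ∫ x in Ioo (0 : ℝ) 1, fracIntLp hβ hβ1 θ φ x * deriv v x
      = θ * (∫ x in Ioo (0 : ℝ) 1, fracInt β 1 ψ x * deriv v x)
        + (1 - θ) * ∫ x in Ioo (0 : ℝ) 1, fracInt β (-1) ψ x * deriv v x := by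
    rw [← integral_const_mul, ← integral_const_mul,
      ← integral_add ((hint 1 (Or.inl rfl)).const_mul θ)
        ((hint (-1) (Or.inr rfl)).const_mul (1 - θ))]
    refine integral_congr_ae ?_
    filter_upwards [coeFn_fracIntLp hβ hβ1 θ φ] with x hx
    rw [hx, lineFracInt_congr_ae h4, lineFracInt]
    ring
  have e2 : ∫ x in Ioo (0 : ℝ) 1, twoSidedFracDerivLp β θ φ x * v x
      = θ * (∫ x in Ioo (0 : ℝ) 1,
          fracDerivLp β (Or.inl rfl : (1 : ℝ) = 1 ∨ (1 : ℝ) = -1) φ x * v x)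
        + (1 - θ) * ∫ x in Ioo (0 : ℝ) 1,
          fracDerivLp β (Or.inr rfl : (-1 : ℝ) = 1 ∨ (-1 : ℝ) = -1) φ x * v x := by
    rw [← integral_const_mul, ← integral_const_mul,
      ← integral_add ((integrable_Lp_mul _ hv.smooth.continuous hv.hasCompactSupport).const_mul θ)
        ((integrable_Lp_mul _ hv.smooth.continuous hv.hasCompactSupport).const_mul (1 - θ))]
    refine integral_congr_ae ?_
    filter_upwards [Lp.coeFn_add (θ • fracDerivLp β (Or.inl rfl : (1 : ℝ) = 1 ∨ (1 : ℝ) = -1) φ)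
      ((1 - θ) • fracDerivLp β (Or.inr rfl : (-1 : ℝ) = 1 ∨ (-1 : ℝ) = -1) φ),
      Lp.coeFn_smul θ (fracDerivLp β (Or.inl rfl : (1 : ℝ) = 1 ∨ (1 : ℝ) = -1) φ),
      Lp.coeFn_smul (1 - θ) (fracDerivLp β (Or.inr rfl : (-1 : ℝ) = 1 ∨ (-1 : ℝ) = -1) φ)]
      with x b1 b2 b3
    have b0 : twoSidedFracDerivLp β θ φ x
      = θ * fracDerivLp β (Or.inl rfl : (1 : ℝ) = 1 ∨ (1 : ℝ) = -1) φ x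
        + (1 - θ) * fracDerivLp β (Or.inr rfl : (-1 : ℝ) = 1 ∨ (-1 : ℝ) = -1) φ x := by
      refine b1.trans ?_
      rw [Pi.add_apply, b2, b3]
      rfl
    rw [b0]
    ring
  rw [e1, e2, ha, hb]
  ring

/-- The two-sided fractional integral operator from `H^{1-β}_0(0, 1)` to `H¹(0, 1)`. -/
def fracIntOp : HZero (1 - β) 0 1 →L[ℝ] HOne 0 1 :=
  (fracIntPair hβ hβ1 hθ0 hθ1).codRestrict (HOne 0 1) (fracIntPair_mem_HOne hβ hβ1 hθ0 hθ1)

theorem fn_fracIntOp (φ : HZero (1 - β) 0 1) :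
    HOne.fn (fracIntOp hβ hβ1 hθ0 hθ1 φ) =ᵐ[volume.restrict (Ioo (0 : ℝ) 1)]
      twoSidedFracInt 0 1 θ β (HZero.fn φ) := by
  obtain ⟨ψ, h1, h2, h3, h4⟩ := HZero.exists_isBddSupp (by linarith) φ.2
  filter_upwards [coeFn_fracIntLp hβ hβ1 θ φ, ae_restrict_mem measurableSet_Ioo] with x hx hx'
  exact hx.trans (twoSidedFracInt_eq h4 h3 hx').symm

theorem cos_pi_mul_pos {β : ℝ} (hβ : 0 < β) (hβ1 : β < 1 / 2) : 0 < Real.cos (Real.pi * β) :=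
  Real.cos_pos_of_mem_Ioo ⟨by nlinarith [Real.pi_pos], by nlinarith [Real.pi_pos]⟩

/-- The first factor of the constant is from the Poincaré inequality, which leaves only the
seminorm; the second inverts the coercivity estimate for the derivative. -/
theorem exists_norm_le_fracIntOp :
    ∃ C : NNReal, ∀ φ, ‖φ‖ ≤ C * ‖fracIntOp hβ hβ1 hθ0 hθ1 φ‖ := by
  have hμ : 1 / 2 < 1 - β := by linarith
  have hS := supConst_nonneg hμ
  have hc := cos_pi_mul_pos hβ hβ1
  have hp : 0 < (2 * Real.pi) ^ (1 - β) := Real.rpow_pos_of_pos Real.two_pi_pos _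
  refine ⟨NNReal.mk ((supConst (1 - β) hμ + 1) *
    (2 / (Real.cos (Real.pi * β) * (2 * Real.pi) ^ (1 - β)))) (by positivity), fun φ => ?_⟩
  have h1 : ‖φ‖ ≤ (supConst (1 - β) hμ + 1) * ‖φ.1.snd‖ := by
    have h2 := HZero.norm_fst_le hμ φ.2
    have h3 : ‖φ‖ ^ 2 = ‖φ.1.fst‖ ^ 2 + ‖φ.1.snd‖ ^ 2 := WithLp.prod_norm_sq_eq_of_L2 φ.1
    have h4 : ‖φ‖ ≤ ‖φ.1.fst‖ + ‖φ.1.snd‖ := by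
      refine le_of_sq_le_sq ?_ (by positivity)
      nlinarith [mul_nonneg (norm_nonneg φ.1.fst) (norm_nonneg φ.1.snd)]
    linarith
  have h5 := norm_snd_le_twoSidedFracDerivLp hβ (by linarith) hθ0 hθ1 φ
  have h6 : ‖twoSidedFracDerivLp β θ φ‖ ≤ ‖fracIntOp hβ hβ1 hθ0 hθ1 φ‖ :=
    WithLp.norm_snd_le _ (fracIntPair hβ hβ1 hθ0 hθ1 φ)
  have h7 : ‖φ.1.snd‖ ≤ 2 / (Real.cos (Real.pi * β) * (2 * Real.pi) ^ (1 - β))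
      * ‖fracIntOp hβ hβ1 hθ0 hθ1 φ‖ := by
    rw [div_mul_eq_mul_div, le_div_iff₀ (mul_pos hc hp)]
    linarith
  refine h1.trans ?_
  rw [NNReal.coe_mk, mul_assoc]
  gcongr

end Operator

/-! ### Identification of the range and conclusion -/

/-- The weak derivative is unique. -/
theorem HOne.ext_of_fn {a b : ℝ} {w z : HOne a b}
    (h : HOne.fn w =ᵐ[volume.restrict (Ioo a b)] HOne.fn z) : w = z := by
  have hfst : w.1.fst = z.1.fst := Lp.ext h
  have hsnd : w.1.snd = z.1.snd := by
    refine Lp.ext ?_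
    have hm := (Lp.memLp w.1.snd).sub (Lp.memLp z.1.snd)
    have h0 : ∀ᵐ x, x ∈ Ioo a b → (w.1.snd - z.1.snd : ℝ → ℝ) x = 0 := by
      refine isOpen_Ioo.ae_eq_zero_of_integral_contDiff_smul_eq_zero ?_ fun v hv hvs hvU => ?_
      · exact IntegrableOn.locallyIntegrableOn (hm.integrable (by norm_num))
      · have hv' : IsTestFunction a b v := ⟨hv, hvs, hvU⟩
        have h1 := w.2 v hv'
        have h2 := z.2 v hv'
        rw [hfst] at h1
        rw [← setIntegral_eq_integral_of_forall_compl_eq_zero (s := Ioo a b)]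
        · have h3 : ∫ x in Ioo a b, v x • (w.1.snd - z.1.snd : ℝ → ℝ) x
              = (∫ x in Ioo a b, w.1.snd x * v x) - ∫ x in Ioo a b, z.1.snd x * v x := by
            rw [← integral_sub (integrable_Lp_mul _ hv.continuous hvs)
              (integrable_Lp_mul _ hv.continuous hvs)]
            congr 1 with x
            rw [Pi.sub_apply, smul_eq_mul]
            ring
          rw [h3]
          linarith
        · intro x hx
          have : v x = 0 := by
            by_contra h
            exact hx (hvU (subset_tsupport v h))
          rw [this, zero_smul]
    filter_upwards [(ae_restrict_iff' measurableSet_Ioo).2 h0] with x hx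
    exact sub_eq_zero.1 hx
  exact Subtype.ext (WithLp.ofLp_injective 2 (Prod.ext hfst hsnd))

theorem range_fracIntOp {β θ : ℝ} (hβ : 0 < β) (hβ1 : β < 1 / 2) (hθ0 : 0 ≤ θ) (hθ1 : θ ≤ 1) :
    Set.range (fracIntOp hβ hβ1 hθ0 hθ1) = fracIntRange β θ := by
  ext w
  constructor
  · rintro ⟨φ, rfl⟩
    exact ⟨φ, fn_fracIntOp hβ hβ1 hθ0 hθ1 φ⟩
  · rintro ⟨φ, hφ⟩
    -- The range is described by functions only; uniqueness of the weak derivative recovers the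
    -- pair.
    exact ⟨φ, HOne.ext_of_fn ((fn_fracIntOp hβ hβ1 hθ0 hθ1 φ).trans hφ.symm)⟩

instance HZero.instCompleteSpace {μ a b : ℝ} : CompleteSpace (HZero μ a b) :=
  ((testGraph μ a b).isClosed_topologicalClosure).completeSpace_coe

end

theorem theorem4p1 (β θ : ℝ) (hβ0 : 0 < β) (hβ1 : β < 1 / 2) (hθ0 : 0 ≤ θ) (hθ1 : θ ≤ 1) :
    -- the integrals converge
    (∀ φ : HZero (1 - β) 0 1, ∀ x ∈ Set.Icc (0 : ℝ) 1,
      IntervalIntegrable (fun s => HZero.fn φ s / (x - s) ^ (1 - β)) volume 0 x ∧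
      IntervalIntegrable (fun s => HZero.fn φ s / (s - x) ^ (1 - β)) volume x 1) ∧
    -- the operator is bounded and linear into `H¹(0, 1)`, a bijection onto its closed range, and
    -- a homeomorphism onto it
    ∃ T : HZero (1 - β) 0 1 →L[ℝ] HOne 0 1,
      (∀ φ, HOne.fn (T φ) =ᵐ[volume.restrict (Set.Ioo (0 : ℝ) 1)]
        twoSidedFracInt 0 1 θ β (HZero.fn φ)) ∧
      Set.BijOn T Set.univ (fracIntRange β θ) ∧
      IsClosed (fracIntRange β θ) ∧
      ∃ e : HZero (1 - β) 0 1 ≃L[ℝ] LinearMap.range T.toLinearMap,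
        ∀ φ, (e φ : HOne 0 1) = T φ := by
  refine ⟨fun φ x hx => ⟨HZero.intervalIntegrable_left hβ0 hβ1 φ hx,
    HZero.intervalIntegrable_right hβ0 hβ1 φ hx⟩, fracIntOp hβ0 hβ1 hθ0 hθ1,
    fn_fracIntOp hβ0 hβ1 hθ0 hθ1, ?_⟩
  obtain ⟨C, hC⟩ := exists_norm_le_fracIntOp hβ0 hβ1 hθ0 hθ1
  have hr := range_fracIntOp hβ0 hβ1 hθ0 hθ1
  -- The lower bound gives injectivity, a closed range because the domain is complete, and the same
  -- `C` as a bound for the inverse.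
  have hanti := (fracIntOp hβ0 hβ1 hθ0 hθ1).antilipschitz_of_bound hC
  have hinj := hanti.injective
  refine ⟨⟨fun φ _ => hr ▸ Set.mem_range_self φ, hinj.injOn, ?_⟩, ?_, ?_⟩
  · rw [Set.SurjOn, Set.image_univ, hr]
  · rw [← hr]
    exact hanti.isClosed_range (fracIntOp hβ0 hβ1 hθ0 hθ1).uniformContinuous
  · refine ⟨(LinearEquiv.ofInjective _ hinj).toContinuousLinearEquivOfBounds
      ‖fracIntOp hβ0 hβ1 hθ0 hθ1‖ C (fun φ => (fracIntOp hβ0 hβ1 hθ0 hθ1).le_opNorm φ)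
      fun w => ?_, fun φ => rfl⟩
    obtain ⟨φ, rfl⟩ := (LinearEquiv.ofInjective _ hinj).surjective w
    rw [LinearEquiv.symm_apply_apply]
    exact hC φ
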